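/- Let $q$ be a prime power, $Q=q^2$, $m\ge 3$ and $n=Q^m-1$. Let $\beta\in\mathbb F_{Q^m}$ be a primitive $n$-th root of unity and, for an integer $\delta\ge 0$, let $\mathcal C_\delta$ be the narrow-sense BCH code of length $n$ and designed distance $\delta$ over $\mathbb F_Q$, i.e. the cyclic code whose generator polynomial is the least common multiple of the minimal polynomials over $\mathbb F_Q$ of $\beta,\beta^2,\dots,\beta^{\delta-1}$. Let $\mathcal C_\delta^{\perp H}=\{x\in\mathbb F_Q^n:\sum_i x_ic_i^q=0\text{ for all }c\in\mathcal C_\delta\}$ be its Hermitian dual. Let $A=(a_{ij})$ be a nonsingular $2\times 2$ matrix over $\mathbb F_Q$, and let $$\mathcal C'_\delta=[\mathcal C_\delta,\mathcal C_\delta^{\perp H}]A=\{(a_{11}u+a_{21}v,\;a_{12}u+a_{22}v):u\in\mathcal C_\delta,\ v\in\mathcal C_\delta^{\perp H}\}.$$ Then $\mathcal C'_\delta$ is a linear code of length $2n$ and dimension $n$. Suppose moreover that both entries $a_{11},a_{12}$ of the first row of $A$ are nonzero. Then, for integers $a,b,s$ as indicated, the minimum distance satisfies $$d(\mathcal C'_\delta)\ge\begin{cases}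 q^{m+1}-aq-s+1,&\text{if $m$ is even, }q\le\sqrt{2s+a^2}+a,\ 1\le a\le q-2,\ 0\le s\le q-1\\&\text{and }(aq+s)q^{m-1}\le\delta\le(aq+s+1)q^{m-1}-1,\\ q^{m+1}-q^2+q-s+1,&\text{if $m$ is even, }0\le s\le q-2\\&\text{and }(q^2-q+s)q^{m-1}\le\delta\le(q^2-q+s+1)q^{m-1}-1,\\ q^{m+1}-q^2+2,&\text{if $m$ is even and }(q^2-1)q^{m-1}\le\delta\le q^{m+1}-q^2+1, \end{cases}$$ and $d(\mathcal C'_\delta)\ge 2\delta$ if one of the following holds: 1. $m$ is odd, $\delta=q^m-b$ and $1\le b\le q^2-2$; 2. $m$ is even, $q>\sqrt{2s+a^2}+a$, $1\le a\le q-2$, $0\le s\le q-1$ and $(aq+s)q^{m-1}\le\delta\le(aq+s+1)q^{m-1}-1$; 3. $m$ is even, $sq^{m-1}\le\delta\le(s+1)q^{m-1}-1$ and $\frac{\sqrt2}{2}q<s\le q-1$; 4. $m$ is odd, $\frac{\sqrt2q^2-2s}{2q}\le a\le q-2$, $0\le s\le q-1$ and $(aq+s)q^{m-2}\le\delta\le(aq+s+1)q^{m-2}-1$;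 5. $m$ is odd, $0\le s\le q-2$, $q\ge 4$ and $(q^2-q+s)q^{m-2}\le\delta\le(q^2-q+s+1)q^{m-2}-1$; 6. $m$ is odd and $(q^2-1)q^{m-2}\le\delta\le q^m-q^2+1$. In each of these cases the stated lower bound for $d(\mathcal C'_\delta)$ is strictly greater than $\sqrt{2n}$. -/

import Mathlib

open Polynomial

namespace BCHMatrixProduct

variable {K : Type*} [Field K]

/-- The generator polynomial of the narrow-sense BCH code of designed distance `δ` with respect to
`β`: the least common multiple of the minimal polynomials over `K` of `β, β², …, β^(δ-1)`.
Minimal polynomials are monic and irreducible, so this is the product of the distinct ones among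
them; `bchGenerator_dvd_iff` is the universal property of the least common multiple. -/
noncomputable def bchGenerator (K : Type*) [Field K] {L : Type*} [Field L] [Algebra K L]
    (β : L) (δ : ℕ) : K[X] :=
  open scoped Classical in
  ∏ p ∈ (Finset.Icc 1 (δ - 1)).image (fun i : ℕ => minpoly K (β ^ i)), p

theorem bchGenerator_dvd_iff {L : Type*} [Field L] [Algebra K L] [FiniteDimensional K L]
    (β : L) (δ : ℕ) (f : K[X]) :
    bchGenerator K β δ ∣ f ↔ ∀ i ∈ Finset.Icc 1 (δ - 1), minpoly K (β ^ i) ∣ f := by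
  classical
  unfold bchGenerator
  constructor
  · intro h i hi
    refine dvd_trans ?_ h
    exact Finset.dvd_prod_of_mem (fun p => p) (Finset.mem_image_of_mem _ hi)
  · intro h
    refine Finset.prod_dvd_of_coprime ?_ ?_
    · intro p hp r hr hpr
      simp only [Finset.coe_image, Set.mem_image] at hp hr
      obtain ⟨i, -, rfl⟩ := hp
      obtain ⟨j, -, rfl⟩ := hr
      have hi := Algebra.IsIntegral.isIntegral (R := K) (β ^ i)
      have hj := Algebra.IsIntegral.isIntegral (R := K) (β ^ j)
      refine ((minpoly.irreducible hi).coprime_iff_not_dvd).2 fun hd => hpr ?_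
      exact eq_of_monic_of_associated (minpoly.monic hi) (minpoly.monic hj)
        ((minpoly.irreducible hi).associated_of_dvd (minpoly.irreducible hj) hd)
    · intro p hp
      obtain ⟨i, hi, rfl⟩ := Finset.mem_image.1 hp
      exact h i hi

/-- The polynomial `c₀ + c₁ X + ⋯ + c_{n-1} X^(n-1)` of a vector `c` of length `n`. -/
noncomputable def vectorPoly {n : ℕ} (c : Fin n → K) : K[X] :=
  ∑ i : Fin n, C (c i) * X ^ (i : ℕ)

/-- The code of length `n` with generator polynomial `g`: the vectors whose polynomial is a
multiple of `g`. It is cyclic when `g` divides `X ^ n - 1`. -/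
noncomputable def polyCode (n : ℕ) (g : K[X]) : Submodule K (Fin n → K) where
  carrier := {c | g ∣ vectorPoly c}
  zero_mem' := by simp [vectorPoly]
  add_mem' := by
    intro a b ha hb
    have h : vectorPoly (a + b) = vectorPoly a + vectorPoly b := by
      simp [vectorPoly, add_mul, Finset.sum_add_distrib]
    simpa only [Set.mem_ofPred_eq, h] using dvd_add ha hb
  smul_mem' := by
    intro t a ha
    have h : vectorPoly (t • a) = C t * vectorPoly a := by
      simp [vectorPoly, Finset.mul_sum, mul_assoc]
    simpa only [Set.mem_ofPred_eq, h] using Dvd.dvd.mul_left ha (C t)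

/-- The narrow-sense BCH code over `K` of length `n` and designed distance `δ` with respect to the
primitive `n`-th root of unity `β`. -/
noncomputable def bchCode (K : Type*) [Field K] {L : Type*} [Field L] [Algebra K L]
    (n : ℕ) (β : L) (δ : ℕ) : Submodule K (Fin n → K) :=
  polyCode n (bchGenerator K β δ)

/-- The Hermitian dual of a code over the field with `q ^ 2` elements, for the form
`⟨x, c⟩ = ∑ i, x i * c i ^ q`. -/
def hermitianDual (q : ℕ) {ι : Type*} [Fintype ι] (D : Submodule K (ι → K)) :
    Submodule K (ι → K) where
  carrier := {x | ∀ c ∈ D, ∑ i, x i * c i ^ q = 0}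
  zero_mem' := by simp
  add_mem' := by
    intro a b ha hb c hc
    simp [add_mul, Finset.sum_add_distrib, ha c hc, hb c hc]
  smul_mem' := by
    intro t a ha c hc
    simp [mul_assoc, ← Finset.mul_sum, ha c hc]

/-- The matrix-product code `[D₁, …, D_s] A` of length `t * n`, consisting of the vectors whose
`j`-th block of length `n` is `∑ i, A i j • c i`, where `c i` runs through `D i`. -/
def matrixProductCode {s t n : ℕ} (D : Fin s → Submodule K (Fin n → K))
    (A : Matrix (Fin s) (Fin t) K) : Submodule K (Fin (t * n) → K) where
  carrier := {w | ∃ c : Fin s → Fin n → K, (∀ i, c i ∈ D i) ∧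
    ∀ k, w k = ∑ i, A i k.divNat * c i k.modNat}
  zero_mem' := ⟨0, fun i => (D i).zero_mem, by simp⟩
  add_mem' := by
    rintro a b ⟨c, hc, ha⟩ ⟨e, he, hb⟩
    refine ⟨c + e, fun i => (D i).add_mem (hc i) (he i), fun k => ?_⟩
    simp [ha, hb, mul_add, Finset.sum_add_distrib]
  smul_mem' := by
    rintro r a ⟨c, hc, ha⟩
    refine ⟨r • c, fun i => (D i).smul_mem r (hc i), fun k => ?_⟩
    simp [ha, Finset.mul_sum, mul_left_comm]

/-- The minimum distance of a code: the least Hamming distance between distinct codewords. -/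
noncomputable def minDist [DecidableEq K] {ι : Type*} [Fintype ι] (D : Submodule K (ι → K)) : ℕ :=
  sInf {d | ∃ u ∈ D, ∃ v ∈ D, u ≠ v ∧ hammingDist u v = d}

end BCHMatrixProduct

/-! A word of the product code comes from a pair (u, v). If v = 0, both blocks are nonzero multiples
of u. If v ≠ 0, nonsingularity of A makes some block nonzero at each position in the support of v.
So the distance is at least min(2 d(C), d(C^⊥H)); the BCH bound gives d(C) ≥ δ, and everything rests
on the dual distance.

Pairing a dual word v with the words Tr(α β^(li)) of C shows that its moment ∑ v_i β^(ij) vanishes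
unless j q^s ≡ -k mod n for some odd s < 2m and 1 ≤ k < δ (`moment_eq_zero_of_mem_hermitianDual`).
As n + 1 = q^(2m), only shifts s close to m can produce such a congruence. For odd m all orders
below 2δ - 1 are free of it, and Vandermonde gives 2δ. For even m put M = q^(m+1) and let δ < (c+1)
q^(m-1): the orders below M - c are free, so the dual distance is at least M - c + 1. If q² ≤ 2c and
δ ≥ c q^(m-1), this is at most 2δ, hence also bounds the product code.

If 2c < q², that bound may fall short of 2δ. But now a run of A = M - 1 - c free orders recurs after
each multiple kM with k ≤ c + 2, and `two_mul_le_card_of_moments` improves the weight to 2A + 2 =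
2(M - c) ≥ 2δ. For a smaller weight, the polynomials N_k interpolating the twisted words u x^(kM)
have such low degree that they form a geometric progression. So do the quotients B_k of X^M N_k -
N_(k+1) by the nodal polynomial. There are c + 2 of these, nonzero and of degree at most c, which
forces a constant ratio. Then x^M is constant on the support, although x ↦ x^M is a Frobenius power
and hence injective. -/

namespace BCHMatrixProduct

/-! ### Vanishing power moments and the weight of a vector -/

section Moments

variable {L ι : Type*} [Field L]

/-- A linear functional supported on finitely many points that kills the monomials of degree less
than `A` kills every polynomial of degree less than `A`. -/
theorem sum_mul_eval_eq_zero {s : Finset ι} {x u : ι → L} {A : ℕ}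
    (h : ∀ a < A, ∑ i ∈ s, u i * x i ^ a = 0) {G : L[X]} (hG : G.degree < A) :
    ∑ i ∈ s, u i * G.eval (x i) = 0 := by
  by_cases h0 : G = 0
  · simp [h0]
  rw [← Polynomial.natDegree_lt_iff_degree_lt h0] at hG
  have hG' : ∀ i, G.eval (x i) = ∑ a ∈ Finset.range A, G.coeff a * x i ^ a := fun i =>
    Polynomial.eval_eq_sum_range' hG (x i)
  simp_rw [hG', Finset.mul_sum]
  rw [Finset.sum_comm]
  refine Finset.sum_eq_zero fun a ha => ?_
  have := h a (Finset.mem_range.1 ha)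
  calc ∑ i ∈ s, u i * (G.coeff a * x i ^ a) = G.coeff a * ∑ i ∈ s, u i * x i ^ a := by
        rw [Finset.mul_sum]; exact Finset.sum_congr rfl fun i _ => by ring
    _ = 0 := by rw [this, mul_zero]

/-- The Vandermonde argument behind the BCH bound. -/
theorem lt_card_of_moments {s : Finset ι} {x u : ι → L} {A : ℕ} (hx : Set.InjOn x s)
    (h : ∀ a < A, ∑ i ∈ s, u i * x i ^ a = 0) (hu : ∃ i ∈ s, u i ≠ 0) : A < s.card := by
  classical
  by_contra! hA
  obtain ⟨i, hi, hui⟩ := hu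
  -- The Lagrange basis polynomial at i has degree |s| - 1 < A, so the functional kills it; its
  -- value there is u i.
  have hdeg : (Lagrange.basis s x i).degree < (A : WithBot ℕ) := by
    rw [Lagrange.degree_basis hx hi]
    have := Finset.card_pos.2 ⟨i, hi⟩
    exact_mod_cast (by omega : s.card - 1 < A)
  have h0 := sum_mul_eval_eq_zero h hdeg
  rw [Finset.sum_eq_single_of_mem i hi, Lagrange.eval_basis_self hx hi, mul_one] at h0
  · exact hui h0
  · intro j hj hji
    rw [Lagrange.eval_basis_of_ne hji.symm hj, mul_zero]

/-- A vector with vanishing moments is given by the values of a polynomial of small degree, up to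
the column multipliers of the dual of a Reed–Solomon code. -/
theorem exists_eval_eq_of_moments [DecidableEq ι] {s : Finset ι} {x u : ι → L} {A : ℕ}
    (hx : Set.InjOn x s) (h : ∀ a < A, ∑ i ∈ s, u i * x i ^ a = 0) (hA : A ≤ s.card) :
    ∃ N : L[X], N.degree < (s.card - A : ℕ) ∧
      ∀ i ∈ s, N.eval (x i) = u i * ∏ j ∈ s.erase i, (x i - x j) := by
  classical
  set r : ι → L := fun i => u i * ∏ j ∈ s.erase i, (x i - x j) with hr
  set N := Lagrange.interpolate s x r with hN
  have heval : ∀ i ∈ s, N.eval (x i) = r i := fun i hi => Lagrange.eval_interpolate_at_node _ hx hi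
  refine ⟨N, ?_, heval⟩
  by_contra! hdeg
  have hN0 : N ≠ 0 := by
    intro h0
    rw [h0] at hdeg
    simp at hdeg
  have hlt : N.degree < s.card := Lagrange.degree_interpolate_lt _ hx
  rw [Polynomial.degree_eq_natDegree hN0] at hdeg hlt
  have hdeg' : s.card - A ≤ N.natDegree := by exact_mod_cast hdeg
  have hlt' : N.natDegree < s.card := by exact_mod_cast hlt
  -- Padding N by X^e brings its leading coefficient to degree |s| - 1, where Lagrange's coefficient
  -- formula reads it as the moment of order e < A.
  set e := s.card - 1 - N.natDegree with he
  have hP : (N * X ^ e).degree < (s.card : WithBot ℕ) := by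
    rw [Polynomial.degree_mul, Polynomial.degree_X_pow, Polynomial.degree_eq_natDegree hN0]
    exact_mod_cast (by omega : N.natDegree + e < s.card)
  have hc := Lagrange.coeff_eq_sum hx hP
  have hidx : s.card - 1 = N.natDegree + e := by omega
  rw [hidx, Polynomial.coeff_mul_X_pow] at hc
  have hsum : ∑ i ∈ s, (N * X ^ e).eval (x i) / ∏ j ∈ s.erase i, (x i - x j) = 0 := by
    rw [← h e (by omega)]
    refine Finset.sum_congr rfl fun i hi => ?_
    have hne : ∏ j ∈ s.erase i, (x i - x j) ≠ 0 := by
      rw [Finset.prod_ne_zero_iff]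
      intro j hj
      rw [Finset.mem_erase] at hj
      exact sub_ne_zero.2 fun hij => hj.1 (hx hj.2 hi hij.symm)
    rw [Polynomial.eval_mul, heval i hi, Polynomial.eval_pow, Polynomial.eval_X, hr]
    field_simp
  rw [hsum] at hc
  exact hN0 (Polynomial.leadingCoeff_eq_zero.1 hc)

/-- If `R ^ k` divides a nonzero polynomial of degree less than `k`, then `R` is constant. -/
theorem natDegree_eq_zero_of_pow_dvd {R B : L[X]} {k : ℕ} (hB : B ≠ 0) (hd : R ^ k ∣ B)
    (hk : B.natDegree < k) : R.natDegree = 0 := by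
  have h := Polynomial.natDegree_le_of_dvd hd hB
  rw [Polynomial.natDegree_pow] at h
  by_contra h0
  have : k * 1 ≤ k * R.natDegree := Nat.mul_le_mul_left k (Nat.pos_of_ne_zero h0)
  omega

/-- If the moments of orders `a + h * M` with `a < A` and `h ≤ M - A + 1` of a vector vanish, where
`x ↦ x ^ M` is injective on its support, then its weight is at least `2 * A + 2`. -/
theorem two_mul_le_card_of_moments {s : Finset ι} {x u : ι → L} {A c M : ℕ}
    (hM : M = A + 1 + c) (hA : 1 ≤ A) (hs : s.Nonempty)
    (hx : Set.InjOn (fun i => x i ^ M) s) (hx0 : ∀ i ∈ s, x i ≠ 0) (hu : ∀ i ∈ s, u i ≠ 0)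
    (h : ∀ k ≤ c + 2, ∀ a < A, ∑ i ∈ s, u i * x i ^ (a + k * M) = 0) : 2 * A + 2 ≤ s.card := by
  classical
  by_contra! hw
  have hxi : Set.InjOn x s := fun i hi j hj hij => hx hi hj (by simp only [hij])
  have hAw : A < s.card := by
    obtain ⟨i, hi⟩ := hs
    refine lt_card_of_moments (u := u) hxi (fun a ha => ?_) ⟨i, hi, hu i hi⟩
    simpa using h 0 (by omega) a ha
  set d : ι → L := fun i => ∏ j ∈ s.erase i, (x i - x j) with hd
  have hd0 : ∀ i ∈ s, d i ≠ 0 := by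
    intro i hi
    rw [hd, Finset.prod_ne_zero_iff]
    intro j hj
    rw [Finset.mem_erase] at hj
    exact sub_ne_zero.2 fun hij => hj.1 (hxi hj.2 hi hij.symm)
  have hex : ∀ k, ∃ N : L[X], k ≤ c + 2 → N.degree < (s.card - A : ℕ) ∧
      ∀ i ∈ s, N.eval (x i) = x i ^ (k * M) * (u i * d i) := by
    intro k
    by_cases hk : k ≤ c + 2
    · obtain ⟨N, h1, h2⟩ := exists_eval_eq_of_moments (u := fun i => u i * x i ^ (k * M)) hxi
        (fun a ha => by
          rw [← h k hk a ha]
          exact Finset.sum_congr rfl fun i _ => by rw [pow_add]; ring) hAw.le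
      exact ⟨N, fun _ => ⟨h1, fun i hi => by rw [h2 i hi, hd]; ring⟩⟩
    · exact ⟨0, fun hk' => absurd hk' hk⟩
  choose N hN using hex
  have hdeg : ∀ k ≤ c + 2, (N k).natDegree + A < s.card := by
    intro k hk
    have := (hN k hk).1
    by_cases h0 : N k = 0
    · simpa [h0] using hAw
    · rw [← Polynomial.natDegree_lt_iff_degree_lt h0] at this
      omega
  obtain ⟨i₀, hi₀⟩ := hs
  have hN0 : ∀ k ≤ c + 2, N k ≠ 0 := by
    intro k hk h0
    have := (hN k hk).2 i₀ hi₀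
    rw [h0, Polynomial.eval_zero] at this
    exact mul_ne_zero (pow_ne_zero _ (hx0 i₀ hi₀)) (mul_ne_zero (hu i₀ hi₀) (hd0 i₀ hi₀)) this.symm
  -- the polynomials `N k` form a geometric progression
  have hcross : ∀ k ≤ c + 1, N 0 * N (k + 1) = N 1 * N k := by
    intro k hk
    -- Each factor has degree at most |s| - A - 1, so each product has degree at most 2(|s| - A - 1)
    -- < |s|, by |s| < 2A + 2.
    refine Polynomial.eq_of_degrees_lt_of_eval_index_eq s hxi ?_ ?_ ?_
    · rw [← Polynomial.natDegree_lt_iff_degree_lt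
        (mul_ne_zero (hN0 _ (by omega)) (hN0 _ (by omega))),
        Polynomial.natDegree_mul (hN0 _ (by omega)) (hN0 _ (by omega))]
      have := hdeg 0 (by omega)
      have := hdeg (k + 1) (by omega)
      omega
    · rw [← Polynomial.natDegree_lt_iff_degree_lt
        (mul_ne_zero (hN0 _ (by omega)) (hN0 _ (by omega))),
        Polynomial.natDegree_mul (hN0 _ (by omega)) (hN0 _ (by omega))]
      have := hdeg 1 (by omega)
      have := hdeg k (by omega)
      omega
    · intro i hi
      rw [Polynomial.eval_mul, Polynomial.eval_mul, (hN 0 (by omega)).2 i hi,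
        (hN 1 (by omega)).2 i hi, (hN k (by omega)).2 i hi, (hN (k + 1) (by omega)).2 i hi]
      ring
  set S := Lagrange.nodal s x with hS
  have hS0 : S ≠ 0 := Lagrange.nodal_ne_zero
  have hSdeg : S.natDegree = s.card := Lagrange.natDegree_nodal
  have hdvd : ∀ k, ∃ B : L[X], k ≤ c + 1 → X ^ M * N k - N (k + 1) = S * B := by
    intro k
    by_cases hk : k ≤ c + 1
    · have : S ∣ X ^ M * N k - N (k + 1) := by
        rw [hS, Lagrange.nodal_eq]
        refine Finset.prod_dvd_of_coprime ?_ ?_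
        · intro i hi j hj hij
          exact Polynomial.isCoprime_X_sub_C_of_isUnit_sub
            (sub_ne_zero.2 fun he => hij (hxi hi hj he)).isUnit
        · intro i hi
          rw [Polynomial.dvd_iff_isRoot, Polynomial.IsRoot, Polynomial.eval_sub,
            Polynomial.eval_mul, Polynomial.eval_pow, Polynomial.eval_X,
            (hN k (by omega)).2 i hi, (hN (k + 1) (by omega)).2 i hi]
          ring
      obtain ⟨B, hB⟩ := this
      exact ⟨B, fun _ => hB⟩
    · exact ⟨0, fun hk' => absurd hk' hk⟩
  choose B hB using hdvd
  -- X^M N_k dominates N_(k+1), so deg B_k = M + deg N_k - |s| ≤ M - A - 1 = c.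
  have hBne : ∀ k ≤ c + 1, B k ≠ 0 ∧ (B k).natDegree ≤ c := by
    intro k hk
    have hk1 := hdeg k (by omega)
    have hk2 := hdeg (k + 1) (by omega)
    have e1 : (X ^ M * N k).natDegree = M + (N k).natDegree := by
      rw [Polynomial.natDegree_mul (pow_ne_zero _ Polynomial.X_ne_zero) (hN0 k (by omega)),
        Polynomial.natDegree_X_pow]
    have e2 : (X ^ M * N k - N (k + 1)).natDegree = M + (N k).natDegree := by
      rw [Polynomial.natDegree_sub_eq_left_of_natDegree_lt, e1]
      omega
    rw [hB k hk] at e2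
    have hB0 : B k ≠ 0 := by
      intro h0
      rw [h0, mul_zero, Polynomial.natDegree_zero] at e2
      omega
    refine ⟨hB0, ?_⟩
    rw [Polynomial.natDegree_mul hS0 hB0, hSdeg] at e2
    omega
  have hBN : ∀ k ≤ c + 1, N k * B 0 = B k * N 0 := by
    intro k hk
    refine mul_left_cancel₀ hS0 ?_
    calc S * (N k * B 0) = N k * (S * B 0) := by ring
      _ = X ^ M * N 0 * N k - N 1 * N k := by rw [← hB 0 (by omega)]; ring
      _ = N 0 * (S * B k) := by rw [← hcross k hk, ← hB k hk]; ring
      _ = S * (B k * N 0) := by ring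
  obtain ⟨g, P, R, hPR, hP, hR⟩ : ∃ g P R : L[X], IsCoprime R P ∧ N 1 = g * P ∧ N 0 = g * R := by
    have hg : EuclideanDomain.gcd (N 0) (N 1) ≠ 0 := by
      intro h0
      exact hN0 0 (by omega) (EuclideanDomain.gcd_eq_zero_iff.1 h0).1
    obtain ⟨R, hR⟩ := EuclideanDomain.gcd_dvd_left (N 0) (N 1)
    obtain ⟨P, hP⟩ := EuclideanDomain.gcd_dvd_right (N 0) (N 1)
    refine ⟨_, P, R, ?_, hP, hR⟩
    have := EuclideanDomain.gcd_eq_gcd_ab (N 0) (N 1)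
    refine ⟨EuclideanDomain.gcdA (N 0) (N 1), EuclideanDomain.gcdB (N 0) (N 1), ?_⟩
    refine mul_left_cancel₀ hg ?_
    calc _ = (EuclideanDomain.gcd (N 0) (N 1) * R) * EuclideanDomain.gcdA (N 0) (N 1)
        + (EuclideanDomain.gcd (N 0) (N 1) * P) * EuclideanDomain.gcdB (N 0) (N 1) := by ring
      _ = _ := by rw [← hR, ← hP, mul_one, ← this]
  have hg : g ≠ 0 := by
    rintro rfl
    exact hN0 0 (by omega) (by rw [hR, zero_mul])
  have hpow : ∀ k ≤ c + 2, N k * R ^ k = P ^ k * N 0 := by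
    intro k
    induction k with
    | zero => intro _; simp
    | succ k ih =>
      intro hk
      have h1 : R * N (k + 1) = P * N k := by
        refine mul_left_cancel₀ hg ?_
        rw [← mul_assoc, ← mul_assoc, ← hR, ← hP, hcross k (by omega)]
      calc N (k + 1) * R ^ (k + 1) = (R * N (k + 1)) * R ^ k := by ring
        _ = P * (N k * R ^ k) := by rw [h1]; ring
        _ = P ^ (k + 1) * N 0 := by rw [ih (by omega)]; ring
  -- B_k and N_k are proportional, so B_(c+1) / B_0 = (P / R)^(c+1) with R and P coprime; a (c+1)-st
  -- power dividing a polynomial of degree at most c is constant.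
  have hBpow : B (c + 1) * R ^ (c + 1) = P ^ (c + 1) * B 0 := by
    refine mul_right_cancel₀ (hN0 0 (by omega)) ?_
    calc _ = (B (c + 1) * N 0) * R ^ (c + 1) := by ring
      _ = (N (c + 1) * R ^ (c + 1)) * B 0 := by rw [← hBN (c + 1) le_rfl]; ring
      _ = _ := by rw [hpow (c + 1) (by omega)]; ring
  have hcop : IsCoprime (R ^ (c + 1)) (P ^ (c + 1)) := hPR.pow
  have hRd : R.natDegree = 0 :=
    natDegree_eq_zero_of_pow_dvd (k := c + 1) (hBne 0 (by omega)).1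
      (hcop.dvd_of_dvd_mul_left (Dvd.intro_left _ hBpow)) (Nat.lt_succ_of_le (hBne 0 (by omega)).2)
  have hPd : P.natDegree = 0 :=
    natDegree_eq_zero_of_pow_dvd (k := c + 1) (hBne (c + 1) le_rfl).1
      (hcop.symm.dvd_of_dvd_mul_right (Dvd.intro _ hBpow.symm))
      (Nat.lt_succ_of_le (hBne (c + 1) le_rfl).2)
  rw [Polynomial.eq_C_of_natDegree_eq_zero hRd] at hR
  rw [Polynomial.eq_C_of_natDegree_eq_zero hPd] at hP
  have hval : ∀ i ∈ s, x i ^ M * R.coeff 0 = P.coeff 0 := by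
    intro i hi
    have e0 := (hN 0 (by omega)).2 i hi
    have e1 := (hN 1 (by omega)).2 i hi
    rw [hR, Polynomial.eval_mul, Polynomial.eval_C] at e0
    rw [hP, Polynomial.eval_mul, Polynomial.eval_C] at e1
    simp only [zero_mul, pow_zero, one_mul] at e0 e1
    have hgi : g.eval (x i) ≠ 0 := by
      intro h0
      rw [h0, zero_mul] at e0
      exact mul_ne_zero (hu i hi) (hd0 i hi) e0.symm
    refine mul_left_cancel₀ hgi ?_
    rw [e1, ← e0]
    ring
  have hR0 : R.coeff 0 ≠ 0 := by
    intro h0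
    rw [h0, Polynomial.C_0, mul_zero] at hR
    exact hN0 0 (by omega) hR
  obtain ⟨i, hi, j, hj, hij⟩ := Finset.one_lt_card.1 (by omega : 1 < s.card)
  exact hij (hx hi hj (mul_right_cancel₀ hR0 ((hval i hi).trans (hval j hj).symm)))

end Moments

/-! ### BCH codes and their Hermitian duals -/

section Codes

variable {K L : Type*} [Field K] [Field L] [Algebra K L]

theorem mem_bchCode_iff [FiniteDimensional K L] {n : ℕ} {β : L} {δ : ℕ} {c : Fin n → K} :
    c ∈ bchCode K n β δ ↔
      ∀ k ∈ Finset.Icc 1 (δ - 1), ∑ i : Fin n, algebraMap K L (c i) * (β ^ k) ^ (i : ℕ) = 0 := by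
  change bchGenerator K β δ ∣ vectorPoly c ↔ _
  rw [bchGenerator_dvd_iff]
  refine forall₂_congr fun k _ => ?_
  simp [vectorPoly, minpoly.dvd_iff, map_sum]

/-- Over a finite field, the Frobenius power `x ↦ x ^ q` is a ring homomorphism whenever the field
has `q ^ 2` elements for a prime power `q`. -/
theorem exists_expChar_pow (L : Type*) [Field L] [Algebra K L] {q : ℕ} (hq : IsPrimePow q)
    (hK : Nat.card K = q ^ 2) :
    ∃ p e : ℕ, q = p ^ e ∧ e ≠ 0 ∧ p.Prime ∧ ExpChar K p ∧ ExpChar L p := by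
  obtain ⟨p, e, hp, he, rfl⟩ := hq
  have hp' : p.Prime := hp.nat_prime
  have : Finite K := Nat.finite_of_card_ne_zero 
    (by rw [hK]; exact pow_ne_zero _ (pow_ne_zero _ hp'.ne_zero))
  have : Fintype K := Fintype.ofFinite K
  obtain ⟨r, hr⟩ := CharP.exists K
  obtain ⟨f, hrp, hcard⟩ := FiniteField.card K r
  rw [← Nat.card_eq_fintype_card, hK, ← pow_mul] at hcard
  have hpr : p = r := by
    have h1 : p ∣ r ^ (f : ℕ) := by
      rw [← hcard]
      exact dvd_pow_self p (by positivity)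
    exact (Nat.prime_dvd_prime_iff_eq hp' hrp).1 (hp'.dvd_of_dvd_pow h1)
  subst hpr
  have h2 : CharP L p := charP_of_injective_algebraMap (algebraMap K L).injective p
  exact ⟨p, e, rfl, he.ne', hp', ExpChar.prime hp', ExpChar.prime hp'⟩

theorem pow_injective_of_expChar {F : Type*} [Field F] {p : ℕ} [ExpChar F p] (e : ℕ) :
    Function.Injective fun x : F => x ^ p ^ e := by
  have h := (iterateFrobenius F p e).injective
  intro x y hxy
  exact h (by simpa [iterateFrobenius_def] using hxy)

theorem trace_pow_eq [FiniteDimensional K L] {q : ℕ} (hq : IsPrimePow q)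
    (hK : Nat.card K = q ^ 2) (x : L) :
    Algebra.trace K L (x ^ q) = Algebra.trace K L x ^ q := by
  obtain ⟨p, e, rfl, -, hp, _, _⟩ := exists_expChar_pow L hq hK
  have : Finite K := Nat.finite_of_card_ne_zero
    (by rw [hK]; exact pow_ne_zero _ (pow_ne_zero _ hp.ne_zero))
  have : Finite L := Module.finite_of_finite K
  refine (algebraMap K L).injective ?_
  rw [RingHom.map_pow, FiniteField.algebraMap_trace_eq_sum_pow,
    FiniteField.algebraMap_trace_eq_sum_pow, sum_pow_char_pow]
  exact Finset.sum_congr rfl fun i _ => by rw [← pow_mul, ← pow_mul, mul_comm]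

theorem sum_pow_eq_zero_of_not_dvd {n : ℕ} {β : L} (hβ : IsPrimitiveRoot β n) {l : ℕ}
    (hl : ¬ n ∣ l) : ∑ i : Fin n, (β ^ l) ^ (i : ℕ) = 0 := by
  rw [Fin.sum_univ_eq_sum_range (fun i => (β ^ l) ^ i) n]
  have h1 : β ^ l - 1 ≠ 0 := sub_ne_zero.2 fun h => hl ((hβ.pow_eq_one_iff_dvd l).1 h)
  refine mul_right_cancel₀ h1 ?_
  rw [geom_sum_mul, zero_mul, ← pow_mul, mul_comm, pow_mul, hβ.pow_eq_one, one_pow, sub_self]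

/-- The moments of a word of the Hermitian dual of a BCH code vanish at every exponent none of
whose odd `q`-shifts is the negative of an element of `[1, δ - 1]` modulo `n`. -/
theorem moment_eq_zero_of_mem_hermitianDual {q m n δ : ℕ} (hq : IsPrimePow q) (hm : 0 < m)
    (hK : Nat.card K = q ^ 2) (hL : Module.finrank K L = m) (hn : n = (q ^ 2) ^ m - 1)
    {β : L} (hβ : IsPrimitiveRoot β n) {v : Fin n → K}
    (hv : v ∈ hermitianDual q (bchCode K n β δ)) {j : ℕ}
    (hj : ∀ s < 2 * m, Odd s → ∀ k ∈ Finset.Icc 1 (δ - 1), ¬ n ∣ j * q ^ s + k) :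
    ∑ i : Fin n, algebraMap K L (v i) * (β ^ (i : ℕ)) ^ j = 0 := by
  obtain ⟨p, e, hqp, -, hp, _, _⟩ := exists_expChar_pow L hq hK
  have hq0 : 0 < q := hq.pos
  have : Finite K := Nat.finite_of_card_ne_zero (by rw [hK]; positivity)
  have hfd : FiniteDimensional K L := Module.finite_of_finrank_pos (by omega)
  have : Finite L := Module.finite_of_finite K
  have hqn : n + 1 = q ^ (2 * m) := by
    rw [hn, pow_mul]
    exact Nat.sub_add_cancel (Nat.one_le_pow _ _ (by positivity))
  -- Since q^(2m) ≡ 1 mod n, this l satisfies lq ≡ j: the q-th power in the Hermitian form turns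
  -- order l into order j.
  set l := j * q ^ (2 * m - 1) with hl
  have hlq : l * q = j * (n + 1) := by
    rw [hl, hqn, mul_assoc, ← pow_succ, Nat.sub_add_cancel (by omega)]
  have hndvd : ∀ r < m, ∀ k ∈ Finset.Icc 1 (δ - 1), ¬ n ∣ l * (q ^ 2) ^ r + k := by
    intro r hr k hk hd
    rcases Nat.eq_zero_or_pos r with rfl | hr0
    · exact hj (2 * m - 1) (by omega) ⟨m - 1, by omega⟩ k hk (by simpa using hd)
    · refine hj (2 * r - 1) (by omega) ⟨r - 1, by omega⟩ k hk ?_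
      have h1 : l * (q ^ 2) ^ r = j * q ^ (2 * r - 1) * n + j * q ^ (2 * r - 1) := by
        have : (q ^ 2) ^ r = q * q ^ (2 * r - 1) := by
          rw [← pow_succ', ← pow_mul]
          congr 1
          omega
        rw [this, ← mul_assoc, hlq]
        ring
      rw [h1, add_assoc] at hd
      exact (Nat.dvd_add_right (Dvd.intro_left _ rfl)).1 hd
  set w : L := ∑ i : Fin n, algebraMap K L (v i) * ((β ^ l) ^ (i : ℕ)) ^ q with hw
  -- The trace expands into conjugates of orders l q^(2r); each contributes a geometric sum that
  -- vanishes by `hndvd`.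
  have hmem : ∀ α : L, (fun i : Fin n => Algebra.trace K L (α * (β ^ l) ^ (i : ℕ))) ∈
      bchCode K n β δ := by
    intro α
    rw [mem_bchCode_iff]
    intro k hk
    simp_rw [FiniteField.algebraMap_trace_eq_sum_pow, Finset.sum_mul]
    rw [Finset.sum_comm]
    refine Finset.sum_eq_zero fun r hr => ?_
    rw [hL, Finset.mem_range] at hr
    rw [hK]
    have := sum_pow_eq_zero_of_not_dvd hβ (hndvd r hr k hk)
    rw [← mul_zero (α ^ (q ^ 2) ^ r), ← this, Finset.mul_sum]
    refine Finset.sum_congr rfl fun i _ => ?_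
    rw [mul_pow, mul_assoc]
    congr 1
    simp only [← pow_mul, ← pow_add]
    congr 1
    ring
  -- Orthogonality to the trace words gives Tr(α^q w) = 0 for all α, and α^q runs through all of L.
  have htr : ∀ a : L, Algebra.trace K L (a * w) = 0 := by
    have hsurj : Function.Surjective fun x : L => x ^ q := by
      rw [hqp]
      exact Finite.surjective_of_injective (pow_injective_of_expChar e)
    intro a
    obtain ⟨α, rfl⟩ := hsurj a
    have h1 := hv _ (hmem α)
    rw [← h1, hw, Finset.mul_sum, map_sum]
    refine Finset.sum_congr rfl fun i _ => ?_
    rw [← trace_pow_eq hq hK, mul_pow, ← smul_eq_mul (v i), ← map_smul, Algebra.smul_def]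
    congr 1
    ring
  have hw0 : w = 0 := by
    have hnd := traceForm_nondegenerate K L
    refine hnd.1 w fun a => ?_
    rw [Algebra.traceForm_apply, mul_comm]
    exact htr a
  rw [← hw0, hw]
  refine Finset.sum_congr rfl fun i _ => ?_
  congr 1
  calc (β ^ (i : ℕ)) ^ j = (β ^ n) ^ (j * i) * (β ^ (i : ℕ)) ^ j := by
        rw [hβ.pow_eq_one, one_pow, one_mul]
    _ = β ^ ((j * (n + 1)) * i) := by rw [← pow_mul, ← pow_mul, ← pow_add]; congr 1; ring
    _ = _ := by rw [← hlq, ← pow_mul, ← pow_mul]; congr 1; ring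

theorem finrank_hermitianDual {q : ℕ} (hq : IsPrimePow q) (hK : Nat.card K = q ^ 2) {n : ℕ}
    (D : Submodule K (Fin n → K)) :
    Module.finrank K (hermitianDual q D) = n - Module.finrank K D := by
  classical
  obtain ⟨p, e, hqp, he, hp, _, _⟩ := exists_expChar_pow K hq hK
  have hq0 : 0 < q := hq.pos
  have : Finite K := Nat.finite_of_card_ne_zero (by rw [hK]; positivity)
  have hnd : (dotProductBilin K K : LinearMap.BilinForm K (Fin n → K)).Nondegenerate := by
    constructor
    · intro x hx
      funext i
      simpa [dotProductBilin] using hx (Pi.single i 1)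
    · intro x hx
      funext i
      simpa [dotProductBilin] using hx (Pi.single i 1)
  set B : LinearMap.BilinForm K (Fin n → K) := dotProductBilin K K with hB
  have hbij : Function.Bijective fun x : K => x ^ q := by
    rw [hqp]
    exact Finite.injective_iff_bijective.1 (pow_injective_of_expChar e)
  have hqq : ∀ x : K, (x ^ q) ^ q = x := by
    intro x
    have := Fintype.ofFinite K
    rw [← pow_mul, ← sq, ← hK, Nat.card_eq_fintype_card, FiniteField.pow_card]
  have hmem : ∀ x : Fin n → K, x ∈ hermitianDual q D ↔ (fun i => x i ^ q) ∈ B.orthogonal D := by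
    intro x
    rw [LinearMap.BilinForm.mem_orthogonal_iff]
    refine forall₂_congr fun c _ => ?_
    have h1 : B c (fun i => x i ^ q) = (∑ i, x i * c i ^ q) ^ q := by
      rw [hqp, sum_pow_char_pow, ← hqp]
      simp [hB, dotProductBilin, dotProduct, mul_pow, hqq, mul_comm]
    rw [h1, pow_eq_zero_iff hq0.ne']
  -- The coordinatewise q-th power carries the Hermitian dual onto the Euclidean one; it is only
  -- semilinear, so cardinalities are compared.
  have hcard : Nat.card (hermitianDual q D) = Nat.card (B.orthogonal D) := by
    refine Nat.card_congr ((Equiv.piCongrRight fun _ => Equiv.ofBijective _ hbij).subtypeEquiv ?_)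
    exact hmem
  rw [Module.natCard_eq_pow_finrank (K := K) (V := hermitianDual q D),
    Module.natCard_eq_pow_finrank (K := K) (V := B.orthogonal D)] at hcard
  have hfin : Module.finrank K (hermitianDual q D) = Module.finrank K (B.orthogonal D) :=
    Nat.pow_right_injective (Nat.succ_le_iff.2 (Finite.one_lt_card (α := K))) hcard
  rw [hfin, LinearMap.BilinForm.finrank_orthogonal hnd, Module.finrank_fin_fun]

end Codes

/-! ### Dimension and distance of a product of two codes -/

section MatrixProduct

variable {K : Type*} [Field K]

theorem mem_matrixProductCode_pair {n : ℕ} {D E : Submodule K (Fin n → K)}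
    {A : Matrix (Fin 2) (Fin 2) K} {w : Fin (2 * n) → K} :
    w ∈ matrixProductCode ![D, E] A ↔ ∃ u ∈ D, ∃ v ∈ E,
      ∀ j i, w (finProdFinEquiv (j, i)) = A 0 j * u i + A 1 j * v i := by
  have hd : ∀ k : Fin (2 * n), finProdFinEquiv (k.divNat, k.modNat) = k := fun k =>
    finProdFinEquiv.apply_symm_apply k
  constructor
  · rintro ⟨c, hc, hw⟩
    refine ⟨c 0, hc 0, c 1, hc 1, fun j i => ?_⟩
    have h1 := hw (finProdFinEquiv (j, i))
    have h2 := finProdFinEquiv.symm_apply_apply (j, i)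
    rw [finProdFinEquiv_symm_apply, Prod.mk.injEq] at h2
    rw [h1, Fin.sum_univ_two, h2.1, h2.2]
  · rintro ⟨u, hu, v, hv, hw⟩
    refine ⟨![u, v], fun i => ?_, fun k => ?_⟩
    · fin_cases i
      · exact hu
      · exact hv
    · rw [Fin.sum_univ_two, ← hd k, hw]
      simp [hd]

theorem eq_zero_of_det_ne_zero {A : Matrix (Fin 2) (Fin 2) K} (hA : A.det ≠ 0) {a b : K}
    (h : ∀ j, A 0 j * a + A 1 j * b = 0) : a = 0 ∧ b = 0 := by
  rw [Matrix.det_fin_two] at hA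
  have h0 := h 0
  have h1 := h 1
  constructor
  · refine (mul_eq_zero.1 (?_ : (A 0 0 * A 1 1 - A 0 1 * A 1 0) * a = 0)).resolve_left hA
    linear_combination A 1 1 * h0 - A 1 0 * h1
  · refine (mul_eq_zero.1 (?_ : (A 0 0 * A 1 1 - A 0 1 * A 1 0) * b = 0)).resolve_left hA
    linear_combination A 0 0 * h1 - A 0 1 * h0

theorem finrank_matrixProductCode_pair {n : ℕ} [Finite K] {D E : Submodule K (Fin n → K)}
    {A : Matrix (Fin 2) (Fin 2) K} (hA : A.det ≠ 0) :
    Module.finrank K (matrixProductCode ![D, E] A) = Module.finrank K D + Module.finrank K E := by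
  let w : D × E → Fin (2 * n) → K := fun x k =>
    A 0 k.divNat * x.1.1 k.modNat + A 1 k.divNat * x.2.1 k.modNat
  have hw : ∀ x j i, w x (finProdFinEquiv (j, i)) = A 0 j * x.1.1 i + A 1 j * x.2.1 i := by
    intro x j i
    have h2 := finProdFinEquiv.symm_apply_apply (j, i)
    rw [finProdFinEquiv_symm_apply, Prod.mk.injEq] at h2
    simp only [w, h2.1, h2.2]
  let f : D × E → matrixProductCode ![D, E] A := fun x =>
    ⟨w x, mem_matrixProductCode_pair.2 ⟨x.1, x.1.2, x.2, x.2.2, hw x⟩⟩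
  have hf : Function.Bijective f := by
    constructor
    · intro x y hxy
      have hxy' : w x = w y := congrArg Subtype.val hxy
      have h0 : ∀ i, x.1.1 i - y.1.1 i = 0 ∧ x.2.1 i - y.2.1 i = 0 := by
        intro i
        refine eq_zero_of_det_ne_zero hA fun j => ?_
        have := congrFun hxy' (finProdFinEquiv (j, i))
        rw [hw, hw] at this
        linear_combination this
      refine Prod.ext (Subtype.ext (funext fun i => sub_eq_zero.1 (h0 i).1))
        (Subtype.ext (funext fun i => sub_eq_zero.1 (h0 i).2))
    · rintro ⟨z, hz⟩
      obtain ⟨u, hu, v, hv, h⟩ := mem_matrixProductCode_pair.1 hz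
      refine ⟨(⟨u, hu⟩, ⟨v, hv⟩), Subtype.ext (funext fun k => ?_)⟩
      obtain ⟨⟨j, i⟩, rfl⟩ := finProdFinEquiv.surjective k
      exact (hw _ j i).trans (h j i).symm
  have hcard := Nat.card_congr (Equiv.ofBijective f hf)
  rw [Nat.card_prod, Module.natCard_eq_pow_finrank (K := K) (V := D),
    Module.natCard_eq_pow_finrank (K := K) (V := E),
    Module.natCard_eq_pow_finrank (K := K) (V := matrixProductCode ![D, E] A), ← pow_add] at hcard
  exact (Nat.pow_right_injective (Nat.succ_le_iff.2 (Finite.one_lt_card (α := K))) hcard).symm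

/-- Nontriviality of D is essential: for the zero code `minDist` is the infimum of the empty set,
which is 0. -/
theorem le_minDist [DecidableEq K] {ι : Type*} [Fintype ι] {D : Submodule K (ι → K)} {d : ℕ}
    (hD : D ≠ ⊥) (h : ∀ w ∈ D, w ≠ 0 → d ≤ hammingNorm w) : d ≤ minDist D := by
  obtain ⟨x, hx, hx0⟩ := Submodule.exists_mem_ne_zero_of_ne_bot hD
  refine le_csInf ⟨_, x, hx, 0, D.zero_mem, hx0, rfl⟩ ?_
  rintro _ ⟨u, hu, v, hv, huv, rfl⟩
  rw [hammingDist_eq_hammingNorm]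
  exact h _ (D.add_mem (D.neg_mem hu) hv) fun h0 => huv (neg_add_eq_zero.1 h0)

/-- The minimum distance of a matrix-product code of two codes, for a nonsingular matrix whose
first row has no zero entry. -/
theorem le_minDist_matrixProductCode_pair [DecidableEq K] {n d : ℕ} {D E : Submodule K (Fin n → K)}
    {A : Matrix (Fin 2) (Fin 2) K} (hA : A.det ≠ 0) (hA0 : ∀ j, A 0 j ≠ 0)
    (hne : matrixProductCode ![D, E] A ≠ ⊥)
    (hD : ∀ u ∈ D, u ≠ 0 → d ≤ 2 * hammingNorm u) (hE : ∀ v ∈ E, v ≠ 0 → d ≤ hammingNorm v) :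
    d ≤ minDist (matrixProductCode ![D, E] A) := by
  classical
  refine le_minDist hne fun w hw hw0 => ?_
  obtain ⟨u, hu, v, hv, h⟩ := mem_matrixProductCode_pair.1 hw
  by_cases hv0 : v = 0
  · subst hv0
    have hu0 : u ≠ 0 := by
      rintro rfl
      refine hw0 (funext fun k => ?_)
      obtain ⟨⟨j, i⟩, rfl⟩ := finProdFinEquiv.surjective k
      simpa using h j i
    refine (hD u hu hu0).trans ?_
    have hcard : ((Finset.univ : Finset (Fin 2)) ×ˢ Finset.univ.filter fun i => u i ≠ 0).card =
        2 * hammingNorm u := by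
      rw [Finset.card_product, Finset.card_univ, Fintype.card_fin, hammingNorm]
    rw [← hcard, hammingNorm]
    refine Finset.card_le_card_of_injOn finProdFinEquiv ?_ finProdFinEquiv.injective.injOn
    rintro ⟨j, i⟩ hji
    simp only [Finset.coe_product, Set.mem_prod, Finset.mem_coe, Finset.mem_filter] at hji
    simp only [Finset.coe_filter, Finset.mem_univ, true_and, Set.mem_ofPred_eq]
    rw [h j i]
    simpa using ⟨hA0 j, hji.2.2⟩
  · refine (hE v hv hv0).trans ?_
    unfold hammingNorm
    refine (Finset.card_le_card ?_).trans (Finset.card_image_le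
      (f := fun k : Fin (2 * n) => (finProdFinEquiv.symm k).2))
    intro i hi
    rw [Finset.mem_filter] at hi
    rw [Finset.mem_image]
    by_contra! hcon
    refine hi.2 (eq_zero_of_det_ne_zero (a := u i) hA fun j => ?_).2
    by_contra hne'
    refine hcon (finProdFinEquiv (j, i)) ?_ (by simp)
    rw [Finset.mem_filter, h j i]
    exact ⟨Finset.mem_univ _, hne'⟩

end MatrixProduct

/-! ### Exponents avoiding the odd q-shifts of -1, …, -(δ - 1) modulo n -/

section Cosets

theorem dvd_add_mul_pow_of_dvd {q m n j k s : ℕ} (hn : n + 1 = q ^ (2 * m)) (hs : s ≤ 2 * m)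
    (h : n ∣ j * q ^ s + k) : n ∣ j + k * q ^ (2 * m - s) := by
  have h1 : (j * q ^ s + k) * q ^ (2 * m - s) = j * n + (j + k * q ^ (2 * m - s)) := by
    have : q ^ s * q ^ (2 * m - s) = n + 1 := by rw [← pow_add, hn, Nat.add_sub_cancel' hs]
    rw [add_mul, mul_assoc, this]
    ring
  exact (Nat.dvd_add_right (Dvd.intro_left _ rfl)).1 (h1 ▸ h.mul_right (q ^ (2 * m - s)))

theorem eq_of_dvd_of_lt_two_mul {n a : ℕ} (h : n ∣ a) (h0 : 0 < a) (h2 : a < 2 * n) : a = n := by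
  obtain ⟨b, rfl⟩ := h
  have hb : b < 2 := by
    by_contra! hb
    nlinarith
  interval_cases b <;> simp_all

/-- For even `m`, the exponents below `q ^ (m + 1) - c` have no odd `q`-shift that is the negative
of an element of `[1, δ - 1]`. -/
theorem not_dvd_of_even {q m n c δ j k s : ℕ} (hq : 2 ≤ q) (hm : 4 ≤ m) (hme : Even m)
    (hn : n + 1 = q ^ (2 * m)) (hc : 1 ≤ c) (hδ : δ + 1 ≤ (c + 1) * q ^ (m - 1))
    (hδ' : δ + q ^ 2 ≤ q ^ (m + 1) + 1) (hj : j + c < q ^ (m + 1)) (hs : s < 2 * m) (hso : Odd s)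
    (hk : k ∈ Finset.Icc 1 (δ - 1)) : ¬ n ∣ j * q ^ s + k := by
  intro hd
  rw [Finset.mem_Icc] at hk
  obtain ⟨r, hr⟩ := hme
  obtain ⟨z, hz⟩ := hso
  obtain ⟨P, hP⟩ : ∃ P, P = q ^ (m - 1) := ⟨_, rfl⟩
  obtain ⟨W, hW⟩ : ∃ W, W = q ^ (m - 3) := ⟨_, rfl⟩
  have hPW : P = q ^ 2 * W := by rw [hP, hW, ← pow_add]; congr 1; omega
  have hMP : q ^ (m + 1) = q ^ 2 * P := by rw [hP, ← pow_add]; congr 1; omega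
  have hnP : n + 1 = q ^ (m + 1) * P := by rw [hn, hP, ← pow_add]; congr 1; omega
  rw [← hP] at hδ
  obtain ⟨M, hM⟩ : ∃ M, M = q ^ (m + 1) := ⟨_, rfl⟩
  rw [← hM] at hMP hnP hj hδ'
  have hq2 : 4 ≤ q ^ 2 := Nat.pow_le_pow_left hq 2
  have hW2 : 2 ≤ W := hW ▸ hq.trans (Nat.le_pow (by omega))
  have hP8 : 8 ≤ P := hPW ▸ Nat.mul_le_mul hq2 hW2
  have hM32 : 32 ≤ M := hMP ▸ Nat.mul_le_mul hq2 hP8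
  have hMP8 : M * 8 ≤ M * P := Nat.mul_le_mul_left M hP8
  have hsmall : ∀ a b e, a < M → b < M → e ≤ m - 3 → a * q ^ e + b < n := by
    intro a b e ha hb he
    have h1 : q ^ e ≤ W := hW ▸ Nat.pow_le_pow_right (by omega) he
    have h2 : a * q ^ e ≤ M * W := Nat.mul_le_mul ha.le h1
    have h3 : 4 * (M * W) ≤ M * P := by
      rw [hPW, mul_left_comm]; exact Nat.mul_le_mul_left M (Nat.mul_le_mul_right W hq2)
    have h4 : M * 2 ≤ M * W := Nat.mul_le_mul_left M hW2
    omega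
  rcases (by omega : s ≤ m - 3 ∨ s = m - 1 ∨ s = m + 1 ∨ 2 * m - s ≤ m - 3) with h | h | h | h
  · have := Nat.le_of_dvd (by omega) hd
    have := hsmall j k s (by omega) (by omega) h
    omega
  -- Here jP + k = n = MP - 1, so k + 1 = (M - j)P ≥ (c + 1)P, too large for k < δ.
  · rw [h, ← hP] at hd
    have h1 : j * P ≤ (M - 1) * P := Nat.mul_le_mul_right P (by omega)
    rw [Nat.sub_mul] at h1
    have he := eq_of_dvd_of_lt_two_mul hd (by omega) (by omega)
    have h3 : k + 1 = (M - j) * P := by rw [Nat.sub_mul]; omega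
    have h4 : (c + 1) * P ≤ (M - j) * P := Nat.mul_le_mul_right P (by omega)
    omega
  -- Here j + kP = MP - 1 with k ≤ M - q², so j ≥ q²P - 1 = M - 1, contrary to j < M - c.
  · have hd' := dvd_add_mul_pow_of_dvd hn (by omega) hd
    rw [h, show 2 * m - (m + 1) = m - 1 by omega, ← hP] at hd'
    have h1 : k * P ≤ (M - q ^ 2) * P := Nat.mul_le_mul_right P (by omega)
    rw [Nat.sub_mul] at h1
    have h2 : 0 < k * P := Nat.mul_pos (by omega) (by omega)
    have he := eq_of_dvd_of_lt_two_mul hd' (by omega) (by omega)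
    omega
  · have hd' := dvd_add_mul_pow_of_dvd hn (by omega) hd
    have h0 : 0 < k * q ^ (2 * m - s) := Nat.mul_pos hk.1 (Nat.pow_pos (by omega))
    have := Nat.le_of_dvd (by omega) hd'
    have := hsmall k j _ (by omega) (by omega) h
    omega

/-- For even `m` and `2 * c < q ^ 2`, the exponents `a + h * q ^ (m + 1)` with
`a < q ^ (m + 1) - c - 1` and `h ≤ c + 2` have no odd `q`-shift that is the negative of an element
of `[1, δ - 1]`. -/
theorem not_dvd_of_even_of_two_mul_lt {q m n c δ a h k s : ℕ} (hq : 3 ≤ q) (hm : 4 ≤ m)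
    (hme : Even m) (hn : n + 1 = q ^ (2 * m)) (hc : 2 * c < q ^ 2)
    (hδ : δ + 1 ≤ (c + 1) * q ^ (m - 1)) (ha : a + 1 + c < q ^ (m + 1)) (hh : h ≤ c + 2)
    (hs : s < 2 * m) (hso : Odd s) (hk : k ∈ Finset.Icc 1 (δ - 1)) :
    ¬ n ∣ (a + h * q ^ (m + 1)) * q ^ s + k := by
  intro hd
  rw [Finset.mem_Icc] at hk
  obtain ⟨r, hr⟩ := hme
  obtain ⟨z, hz⟩ := hso
  obtain ⟨P, hP⟩ : ∃ P, P = q ^ (m - 1) := ⟨_, rfl⟩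
  obtain ⟨W, hW⟩ : ∃ W, W = q ^ (m - 3) := ⟨_, rfl⟩
  obtain ⟨Y, hY⟩ : ∃ Y, Y = q ^ (2 * m - 3) := ⟨_, rfl⟩
  have hPW : P = q ^ 2 * W := by rw [hP, hW, ← pow_add]; congr 1; omega
  have hMP : q ^ (m + 1) = q ^ 2 * P := by rw [hP, ← pow_add]; congr 1; omega
  have hnP : n + 1 = q ^ (m + 1) * P := by rw [hn, hP, ← pow_add]; congr 1; omega
  have hPP : P * P = q * Y := by rw [hP, hY, ← pow_add, ← pow_succ']; congr 1; omega
  have hMW : q ^ (m + 1) * W = q * Y := by rw [hW, hY, ← pow_add, ← pow_succ']; congr 1; omega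
  have hMY : q ^ (m + 1) ≤ Y := hY ▸ Nat.pow_le_pow_right (by omega) (by omega)
  have hnY : n + 1 = q ^ 3 * Y := by rw [hn, hY, ← pow_add]; congr 1; omega
  rw [← hP] at hδ
  obtain ⟨M, hM⟩ : ∃ M, M = q ^ (m + 1) := ⟨_, rfl⟩
  rw [← hM] at hMP hnP ha hMW hMY hd
  have hjlt : a + h * M < (c + 3) * M := by
    have e1 : h * M ≤ (c + 2) * M := Nat.mul_le_mul_right M hh
    have e2 : (c + 3) * M = (c + 2) * M + M := by ring
    omega
  obtain ⟨j, hj⟩ : ∃ j, j = a + h * M := ⟨_, rfl⟩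
  rw [← hj] at hjlt hd
  have hq2 : 9 ≤ q ^ 2 := Nat.pow_le_pow_left hq 2
  have hW3 : 3 ≤ W := hW ▸ hq.trans (Nat.le_pow (by omega))
  have hqP : q ^ 2 * 3 ≤ P := hPW ▸ Nat.mul_le_mul_left _ hW3
  have hPM : 9 * P ≤ M := hMP ▸ Nat.mul_le_mul_right P hq2
  have hMP8 : M * 8 ≤ M * P := Nat.mul_le_mul_left M (by omega)
  have hq3 : q ^ 3 = q * q ^ 2 := by ring
  have hqq : 3 * q ≤ q ^ 2 := by rw [sq]; exact Nat.mul_le_mul_right q hq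
  have hqq3 : 3 * q ^ 2 ≤ q ^ 3 := by rw [hq3]; exact Nat.mul_le_mul_right _ hq
  have hkM : k < M := by
    have : (c + 1) * P ≤ q ^ 2 * P := Nat.mul_le_mul_right P (by omega)
    omega
  have hY0 : 1 ≤ Y := by omega
  rcases (by omega : s ≤ m - 3 ∨ s = m - 1 ∨ 2 * m - s ≤ m - 1) with hs' | hs' | hs'
  · have h1 : q ^ s ≤ W := hW ▸ Nat.pow_le_pow_right (by omega) hs'
    have h2 : j * q ^ s ≤ (c + 3) * M * W := Nat.mul_le_mul hjlt.le h1
    rw [mul_assoc, hMW] at h2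
    have h3 : 2 * ((c + 3) * (q * Y)) ≤ (q ^ 2 + 5) * (q * Y) := by
      rw [← mul_assoc]; exact Nat.mul_le_mul_right _ (by omega)
    have h4 : (5 * q + 3) * Y ≤ q ^ 3 * Y := Nat.mul_le_mul_right _ (by omega)
    have h5 : (q ^ 2 + 5) * (q * Y) = q ^ 3 * Y + 5 * (q * Y) := by ring
    have h6 : (5 * q + 3) * Y = 5 * (q * Y) + 3 * Y := by ring
    have := Nat.le_of_dvd (by omega) hd
    omega
  -- Writing the multiple as κn gives k + κ = (κM - j)P, so j lies at most c + 1 below κM; but a + 1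
  -- + c < M keeps j = a + hM clear of that gap.
  · rw [hs', ← hP] at hd
    obtain ⟨κ, hκ⟩ := hd
    have h1 : k + κ + j * P = κ * M * P := by
      rw [mul_assoc, ← hnP, mul_add, mul_one, mul_comm κ n]; omega
    have h2 : j < κ * M := by
      by_contra! hcon
      have : κ * M * P ≤ j * P := Nat.mul_le_mul_right P hcon
      omega
    have h3 : κ ≤ c + 3 := by
      by_contra! hcon
      have e1 : j * P ≤ (c + 3) * M * P := Nat.mul_le_mul_right P hjlt.le
      have e2 : (c + 4) * n ≤ n * κ := by rw [mul_comm n]; exact Nat.mul_le_mul_right n hcon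
      rw [mul_assoc, ← hnP] at e1
      have e4 : (c + 4) * n = (c + 3) * n + n := by ring
      have e5 : (c + 3) * (n + 1) = (c + 3) * n + (c + 3) := by ring
      omega
    have h4 : κ * M - j ≤ c + 1 := by
      by_contra! hcon
      have e1 : (c + 2) * P ≤ (κ * M - j) * P := Nat.mul_le_mul_right P hcon
      rw [Nat.sub_mul] at e1
      have e2 : (c + 2) * P = (c + 1) * P + P := by ring
      omega
    rcases Nat.lt_or_ge h κ with h5 | h5
    · have : (h + 1) * M ≤ κ * M := Nat.mul_le_mul_right M h5
      rw [add_mul, one_mul] at this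
      omega
    · have : κ * M ≤ h * M := Nat.mul_le_mul_right M h5
      omega
  -- As 2c < q², the term k q^(2m-s) is at most about n/2, and j is small enough to keep the sum
  -- below n.
  · have hd' := dvd_add_mul_pow_of_dvd hn (by omega) hd
    have h0 : 0 < k * q ^ (2 * m - s) := Nat.mul_pos hk.1 (Nat.pow_pos (by omega))
    have h1 : q ^ (2 * m - s) ≤ P := hP ▸ Nat.pow_le_pow_right (by omega) hs'
    have h2 : k * q ^ (2 * m - s) ≤ (c + 1) * P * P := Nat.mul_le_mul (by omega) h1
    rw [mul_assoc, hPP] at h2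
    have h3 : 2 * ((c + 1) * (q * Y)) ≤ (q ^ 2 + 1) * (q * Y) := by
      rw [← mul_assoc]; exact Nat.mul_le_mul_right _ (by omega)
    have h5 : 2 * ((c + 3) * M) ≤ (q ^ 2 + 5) * Y := by
      rw [← mul_assoc]; exact Nat.mul_le_mul (by omega) hMY
    have h4 : (q ^ 2 + q + 8) * Y ≤ q ^ 3 * Y := Nat.mul_le_mul_right _ (by omega)
    have h6 : (q ^ 2 + 1) * (q * Y) = q ^ 3 * Y + q * Y := by ring
    have h7 : (q ^ 2 + 5) * Y = q ^ 2 * Y + 5 * Y := by ring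
    have h8 : (q ^ 2 + q + 8) * Y = q ^ 2 * Y + q * Y + 8 * Y := by ring
    have := Nat.le_of_dvd (by omega) hd'
    omega

/-- For odd `m`, the exponents below `2 * δ - 1` have no odd `q`-shift that is the negative of an
element of `[1, δ - 1]`. -/
theorem not_dvd_of_odd {q m n δ j k s : ℕ} (hq : 2 ≤ q) (hm : 3 ≤ m) (hmo : Odd m)
    (hn : n + 1 = q ^ (2 * m)) (hδ : δ < q ^ m) (hj : j + 1 < 2 * δ) (hs : s < 2 * m)
    (hso : Odd s) (hk : k ∈ Finset.Icc 1 (δ - 1)) : ¬ n ∣ j * q ^ s + k := by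
  intro hd
  rw [Finset.mem_Icc] at hk
  obtain ⟨r, hr⟩ := hmo
  obtain ⟨z, hz⟩ := hso
  obtain ⟨W, hW⟩ : ∃ W, W = q ^ (m - 2) := ⟨_, rfl⟩
  obtain ⟨X, hX⟩ : ∃ X, X = q ^ m := ⟨_, rfl⟩
  have hXW : X = q ^ 2 * W := by rw [hX, hW, ← pow_add]; congr 1; omega
  have hnX : n + 1 = X * X := by rw [hn, hX, ← pow_add]; congr 1; omega
  rw [← hX] at hδ
  have hq2 : 4 ≤ q ^ 2 := Nat.pow_le_pow_left hq 2
  have hW2 : 2 ≤ W := hW ▸ hq.trans (Nat.le_pow (by omega))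
  have hX8 : 8 ≤ X := hXW ▸ Nat.mul_le_mul hq2 hW2
  have h2W : X * 2 ≤ X * W := Nat.mul_le_mul_left X hW2
  have h4W : X * (4 * W) ≤ X * X :=
    Nat.mul_le_mul_left X (hXW ▸ Nat.mul_le_mul_right W hq2)
  rw [mul_left_comm] at h4W
  rcases (by omega : s ≤ m - 2 ∨ s = m ∨ 2 * m - s ≤ m - 2) with h | h | h
  · have h1 : q ^ s ≤ W := hW ▸ Nat.pow_le_pow_right (by omega) h
    have h2 : j * q ^ s ≤ 2 * X * W := Nat.mul_le_mul (by omega) h1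
    rw [mul_assoc] at h2
    have := Nat.le_of_dvd (by omega) hd
    omega
  -- The sum is below 2n, so jX + k = X² - 1; this forces j < X, and then k ≥ X - 1, contrary to k <
  -- δ < X.
  · rw [h, ← hX] at hd
    have h1 : (j + 2) * X ≤ (2 * X) * X := Nat.mul_le_mul_right X (by omega)
    rw [add_mul, mul_assoc] at h1
    have he := eq_of_dvd_of_lt_two_mul hd (by omega) (by omega)
    have h3 : j < X := by
      by_contra! hcon
      have := Nat.mul_le_mul_right X hcon
      omega
    have h4 : (j + 1) * X ≤ X * X := Nat.mul_le_mul_right X h3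
    rw [add_mul] at h4
    omega
  · have hd' := dvd_add_mul_pow_of_dvd hn (by omega) hd
    have h0 : 0 < k * q ^ (2 * m - s) := Nat.mul_pos hk.1 (Nat.pow_pos (by omega))
    have h1 : q ^ (2 * m - s) ≤ W := hW ▸ Nat.pow_le_pow_right (by omega) h
    have h2 : k * q ^ (2 * m - s) ≤ X * W := Nat.mul_le_mul (by omega) h1
    have := Nat.le_of_dvd (by omega) hd'
    omega

end Cosets

/-! ### Lower bounds for the weights of both codes -/

section Distance

variable {K L : Type*} [Field K] [Field L] [Algebra K L]

theorem lt_hammingNorm_of_moments [DecidableEq K] {n : ℕ} {β : L} (hβ : IsPrimitiveRoot β n)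
    {v : Fin n → K} (hv : v ≠ 0) (r : ℕ) {A : ℕ}
    (h : ∀ a < A, ∑ i : Fin n, algebraMap K L (v i) * (β ^ (i : ℕ)) ^ (a + r) = 0) :
    A < hammingNorm v := by
  obtain ⟨i₀, hi₀⟩ := Function.ne_iff.1 hv
  have hβ0 : β ≠ 0 := hβ.ne_zero (by have := i₀.2; omega)
  refine lt_card_of_moments (x := fun i : Fin n => β ^ (i : ℕ))
    (u := fun i => algebraMap K L (v i) * (β ^ (i : ℕ)) ^ r) ?_ ?_ ?_
  · intro i _ j _ hij
    exact Fin.ext (hβ.pow_inj i.2 j.2 hij)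
  · intro a ha
    rw [← h a ha, Finset.sum_filter_of_ne]
    · exact Finset.sum_congr rfl fun i _ => by rw [pow_add]; ring
    · intro i _ hi h0
      exact hi (by simp [h0])
  · exact ⟨i₀, Finset.mem_filter.2 ⟨Finset.mem_univ _, hi₀⟩,
      mul_ne_zero ((_root_.map_ne_zero _).2 hi₀) (pow_ne_zero _ (pow_ne_zero _ hβ0))⟩

/-- The BCH bound. -/
theorem le_hammingNorm_of_mem_bchCode [DecidableEq K] [FiniteDimensional K L] {n δ : ℕ} {β : L}
    (hβ : IsPrimitiveRoot β n) {u : Fin n → K} (hu : u ∈ bchCode K n β δ) (hu0 : u ≠ 0) :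
    δ ≤ hammingNorm u := by
  have := lt_hammingNorm_of_moments hβ hu0 1 (A := δ - 1) fun a ha => by
    rw [mem_bchCode_iff] at hu
    rw [← hu (a + 1) (Finset.mem_Icc.2 ⟨by omega, by omega⟩)]
    exact Finset.sum_congr rfl fun i _ => by rw [pow_right_comm]
  omega

theorem add_one_eq_pow {q m n : ℕ} (hq : 0 < q) (hn : n = (q ^ 2) ^ m - 1) :
    n + 1 = q ^ (2 * m) := by
  rw [hn, pow_mul]
  exact Nat.sub_add_cancel (Nat.one_le_pow _ _ (by positivity))

theorem le_hammingNorm_hermitianDual_of_even [DecidableEq K] {q m n c δ : ℕ} (hq : IsPrimePow q)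
    (hm : 4 ≤ m) (hme : Even m) (hK : Nat.card K = q ^ 2) (hL : Module.finrank K L = m)
    (hn : n = (q ^ 2) ^ m - 1) {β : L} (hβ : IsPrimitiveRoot β n) (hc : 1 ≤ c)
    (hδ : δ + 1 ≤ (c + 1) * q ^ (m - 1)) (hδ' : δ + q ^ 2 ≤ q ^ (m + 1) + 1) {v : Fin n → K}
    (hv : v ∈ hermitianDual q (bchCode K n β δ)) (hv0 : v ≠ 0) :
    q ^ (m + 1) - c + 1 ≤ hammingNorm v :=
  lt_hammingNorm_of_moments hβ hv0 0 fun _ ha =>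
    moment_eq_zero_of_mem_hermitianDual hq (by omega) hK hL hn hβ hv fun _ hs hso _ hk =>
      not_dvd_of_even hq.two_le hm hme (add_one_eq_pow hq.pos hn) hc hδ hδ' (by omega) hs hso hk

theorem le_hammingNorm_hermitianDual_of_odd [DecidableEq K] {q m n δ : ℕ} (hq : IsPrimePow q)
    (hm : 3 ≤ m) (hmo : Odd m) (hK : Nat.card K = q ^ 2) (hL : Module.finrank K L = m)
    (hn : n = (q ^ 2) ^ m - 1) {β : L} (hβ : IsPrimitiveRoot β n)
    (hδ : δ < q ^ m) {v : Fin n → K}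
    (hv : v ∈ hermitianDual q (bchCode K n β δ)) (hv0 : v ≠ 0) :
    2 * δ ≤ hammingNorm v := by
  have := lt_hammingNorm_of_moments hβ hv0 0 (A := 2 * δ - 1) fun _ ha =>
    moment_eq_zero_of_mem_hermitianDual hq (by omega) hK hL hn hβ hv fun _ hs hso _ hk =>
      not_dvd_of_odd hq.two_le hm hmo (add_one_eq_pow hq.pos hn) hδ (by omega) hs hso hk
  omega

theorem two_mul_le_hammingNorm_hermitianDual [DecidableEq K] {q m n c δ : ℕ} (hq : IsPrimePow q)
    (hq3 : 3 ≤ q) (hm : 4 ≤ m) (hme : Even m) (hK : Nat.card K = q ^ 2)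
    (hL : Module.finrank K L = m) (hn : n = (q ^ 2) ^ m - 1) {β : L} (hβ : IsPrimitiveRoot β n)
    (hc : 2 * c < q ^ 2) (hδ : δ + 1 ≤ (c + 1) * q ^ (m - 1)) {v : Fin n → K}
    (hv : v ∈ hermitianDual q (bchCode K n β δ)) (hv0 : v ≠ 0) :
    2 * (q ^ (m + 1) - c) ≤ hammingNorm v := by
  obtain ⟨p, e, hqp, -, -, _, _⟩ := exists_expChar_pow L hq hK
  have hcM : c + 2 < q ^ (m + 1) := by
    have e1 : q ^ 3 ≤ q ^ (m + 1) := Nat.pow_le_pow_right (by omega) (by omega)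
    have e2 : q ^ 2 * 3 ≤ q ^ 3 := by rw [pow_succ]; exact Nat.mul_le_mul_left _ hq3
    have e3 : 3 ^ 2 ≤ q ^ 2 := Nat.pow_le_pow_left hq3 2
    omega
  obtain ⟨i₀, hi₀⟩ := Function.ne_iff.1 hv0
  have hβ0 : β ≠ 0 := hβ.ne_zero (by have := i₀.2; omega)
  have := two_mul_le_card_of_moments (s := Finset.univ.filter fun i => v i ≠ 0)
    (x := fun i : Fin n => β ^ (i : ℕ)) (u := fun i => algebraMap K L (v i))
    (A := q ^ (m + 1) - 1 - c) (c := c) (M := q ^ (m + 1)) (by omega) (by omega)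
    ⟨i₀, Finset.mem_filter.2 ⟨Finset.mem_univ _, hi₀⟩⟩ ?_ (fun i _ => pow_ne_zero _ hβ0)
    (fun i hi => (_root_.map_ne_zero _).2 (Finset.mem_filter.1 hi).2) ?_
  · rw [hammingNorm]
    omega
  · intro i _ j _ hij
    simp only [hqp, ← pow_mul p] at hij
    exact Fin.ext (hβ.pow_inj i.2 j.2 (pow_injective_of_expChar _ hij))
  · intro k hk a ha
    rw [Finset.sum_filter_of_ne]
    · exact moment_eq_zero_of_mem_hermitianDual hq (by omega) hK hL hn hβ hv fun _ hs hso _ hk' =>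
        not_dvd_of_even_of_two_mul_lt hq3 hm hme (add_one_eq_pow hq.pos hn) hc hδ (by omega) hk hs
          hso hk'
    · intro i _ hi h0
      exact hi (by simp [h0])

end Distance

/-! ### The distance of the product code and comparison with √(2n) -/

section Main

/-- The value 3/2 would be too coarse: for q = m = 3 and δ = 20, 2δ = 40 is less than 27 · 3/2. -/
theorem sqrt_two_le : √2 ≤ 17 / 12 := by
  rw [Real.sqrt_le_left (by norm_num)]
  norm_num

theorem sqrt_two_mul_lt {q m n : ℕ} (hq : 0 < q) (hn : n + 1 = q ^ (2 * m)) {B : ℝ}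
    (hB : √2 * (q : ℝ) ^ m ≤ B) : √(2 * n) < B := by
  have hX : (0 : ℝ) < (q : ℝ) ^ m := by positivity
  refine lt_of_lt_of_le ?_ hB
  rw [Real.sqrt_lt' (by positivity), mul_pow, Real.sq_sqrt (by norm_num), ← pow_mul, mul_comm m 2]
  have : (n : ℝ) + 1 = (q : ℝ) ^ (2 * m) := by exact_mod_cast hn
  linarith

variable {K L : Type*} [Field K] [Field L] [Algebra K L]

theorem finrank_matrixProductCode_bchCode {q n δ : ℕ} (hq : IsPrimePow q)
    (hK : Nat.card K = q ^ 2) (β : L) {A : Matrix (Fin 2) (Fin 2) K}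
    (hA : A.det ≠ 0) :
    Module.finrank K (matrixProductCode ![bchCode K n β δ,
      hermitianDual q (bchCode K n β δ)] A) = n := by
  have hq0 := hq.pos
  have : Finite K := Nat.finite_of_card_ne_zero (by rw [hK]; positivity)
  rw [finrank_matrixProductCode_pair hA, finrank_hermitianDual hq hK]
  have := Submodule.finrank_le (bchCode K n β δ)
  rw [Module.finrank_fin_fun] at this
  omega

theorem le_minDist_matrixProductCode_bchCode [DecidableEq K] {q m n δ d : ℕ} (hq : IsPrimePow q) (hm : 0 < m)
    (hK : Nat.card K = q ^ 2) (hL : Module.finrank K L = m) (hn : n = (q ^ 2) ^ m - 1)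
    {β : L} (hβ : IsPrimitiveRoot β n) {A : Matrix (Fin 2) (Fin 2) K}
    (hA : A.det ≠ 0) (hA0 : ∀ j, A 0 j ≠ 0) (hd : d ≤ 2 * δ)
    (h : ∀ v ∈ hermitianDual q (bchCode K n β δ), v ≠ 0 → d ≤ hammingNorm v) :
    d ≤ minDist (matrixProductCode ![bchCode K n β δ, hermitianDual q (bchCode K n β δ)] A) := by
  have hfd : FiniteDimensional K L := Module.finite_of_finrank_pos (by omega)
  refine le_minDist_matrixProductCode_pair hA hA0 ?_ (fun u hu hu0 => ?_) h
  · intro hbot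
    have h1 := finrank_matrixProductCode_bchCode (n := n) (δ := δ) hq hK β hA
    rw [hbot, finrank_bot] at h1
    have h2 := add_one_eq_pow hq.pos hn
    have h3 : 2 ^ 1 ≤ q ^ (2 * m) :=
      (Nat.pow_le_pow_left hq.two_le 1).trans (Nat.pow_le_pow_right hq.pos (by omega))
    omega
  · have := le_hammingNorm_of_mem_bchCode hβ hu hu0
    omega

theorem pow_succ_eq {q m : ℕ} (hm : 1 ≤ m) : q ^ (m + 1) = q ^ 2 * q ^ (m - 1) := by
  rw [← pow_add]
  congr 1
  omega

theorem sq_le_pow_sub {q m : ℕ} (hq : 0 < q) (hm : 4 ≤ m) : q ^ 2 ≤ q ^ (m - 1) :=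
  Nat.pow_le_pow_right hq (by omega)

theorem le_minDist_of_even [DecidableEq K] {q m n c δ : ℕ} (hq : IsPrimePow q) (hm : 4 ≤ m) (hme : Even m)
    (hK : Nat.card K = q ^ 2) (hL : Module.finrank K L = m) (hn : n = (q ^ 2) ^ m - 1)
    {β : L} (hβ : IsPrimitiveRoot β n) {A : Matrix (Fin 2) (Fin 2) K}
    (hA : A.det ≠ 0) (hA0 : ∀ j, A 0 j ≠ 0) (hc : q ^ 2 ≤ 2 * c) (hc' : c < q ^ 2)
    (hδc : c * q ^ (m - 1) ≤ δ) (hδ : δ + 1 ≤ (c + 1) * q ^ (m - 1))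
    (hδ' : δ + q ^ 2 ≤ q ^ (m + 1) + 1) :
    √(2 * n) < (q : ℝ) ^ (m + 1) - c + 1 ∧ (q : ℝ) ^ (m + 1) - c + 1 ≤
      minDist (matrixProductCode ![bchCode K n β δ, hermitianDual q (bchCode K n β δ)] A) := by
  have hq0 := hq.pos
  have hq2 : 2 ^ 2 ≤ q ^ 2 := Nat.pow_le_pow_left hq.two_le 2
  have hqm : q ^ 2 * 2 ^ 2 ≤ q ^ m := by
    calc q ^ 2 * 2 ^ 2 ≤ q ^ 2 * q ^ 2 := Nat.mul_le_mul_left _ hq2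
      _ = q ^ 4 := by ring
      _ ≤ q ^ m := Nat.pow_le_pow_right hq0 hm
  have h2m : 2 * q ^ m ≤ q ^ (m + 1) := by
    rw [pow_succ']; exact Nat.mul_le_mul_right _ hq.two_le
  constructor
  · refine sqrt_two_mul_lt hq0 (add_one_eq_pow hq0 hn) ?_
    have e1 : √2 * (q : ℝ) ^ m ≤ 17 / 12 * (q : ℝ) ^ m :=
      mul_le_mul_of_nonneg_right sqrt_two_le (by positivity)
    have e2 : (c : ℝ) ≤ (q : ℝ) ^ 2 := by exact_mod_cast hc'.le
    have e3 : (q : ℝ) ^ 2 * 2 ^ 2 ≤ (q : ℝ) ^ m := by exact_mod_cast hqm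
    have e4 : 2 * (q : ℝ) ^ m ≤ (q : ℝ) ^ (m + 1) := by exact_mod_cast h2m
    linarith
  · have h1 : q ^ 2 * q ^ (m - 1) ≤ 2 * c * q ^ (m - 1) := Nat.mul_le_mul_right _ hc
    rw [← pow_succ_eq (by omega), mul_assoc] at h1
    have h2 := le_minDist_matrixProductCode_bchCode (δ := δ) (d := q ^ (m + 1) - c + 1) hq
      (by omega) hK hL hn hβ hA hA0 (by omega) fun v hv hv0 =>
        le_hammingNorm_hermitianDual_of_even hq hm hme hK hL hn hβ (by omega) hδ hδ' hv hv0
    generalize minDist (matrixProductCode ![bchCode K n β δ,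
      hermitianDual q (bchCode K n β δ)] A) = d at h2 ⊢
    have h3 : q ^ (m + 1) + 1 ≤ d + c := by omega
    have h4 : (q : ℝ) ^ (m + 1) + 1 ≤ d + c := by exact_mod_cast h3
    linarith

theorem two_mul_le_minDist_of_even [DecidableEq K] {q m n c δ : ℕ} (hq : IsPrimePow q)
    (hq3 : 3 ≤ q) (hm : 4 ≤ m) (hme : Even m) (hK : Nat.card K = q ^ 2) (hL : Module.finrank K L = m)
    (hn : n = (q ^ 2) ^ m - 1) {β : L} (hβ : IsPrimitiveRoot β n) {A : Matrix (Fin 2) (Fin 2) K}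
    (hA : A.det ≠ 0) (hA0 : ∀ j, A 0 j ≠ 0) (hc : 2 * c < q ^ 2)
    (hδ : δ + 1 ≤ (c + 1) * q ^ (m - 1)) : 2 * δ ≤
      minDist (matrixProductCode ![bchCode K n β δ, hermitianDual q (bchCode K n β δ)] A) := by
  refine le_minDist_matrixProductCode_bchCode hq (by omega) hK hL hn hβ hA hA0 le_rfl
    fun v hv hv0 => le_trans ?_
      (two_mul_le_hammingNorm_hermitianDual hq hq3 hm hme hK hL hn hβ hc hδ hv hv0)
  have h1 : 2 * (c + 1) * q ^ (m - 1) ≤ (q ^ 2 + 1) * q ^ (m - 1) :=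
    Nat.mul_le_mul_right _ (by omega)
  rw [mul_assoc, add_mul (q ^ 2), ← pow_succ_eq (by omega)] at h1
  have h2 : 3 ^ 2 * q ^ (m - 1) ≤ q ^ 2 * q ^ (m - 1) :=
    Nat.mul_le_mul_right _ (Nat.pow_le_pow_left hq3 2)
  rw [← pow_succ_eq (by omega)] at h2
  have h3 := sq_le_pow_sub hq.pos hm
  omega

theorem two_mul_le_minDist_of_odd [DecidableEq K] {q m n δ : ℕ} (hq : IsPrimePow q) (hm : 3 ≤ m)
    (hmo : Odd m) (hK : Nat.card K = q ^ 2) (hL : Module.finrank K L = m)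
    (hn : n = (q ^ 2) ^ m - 1) {β : L} (hβ : IsPrimitiveRoot β n) {A : Matrix (Fin 2) (Fin 2) K}
    (hA : A.det ≠ 0) (hA0 : ∀ j, A 0 j ≠ 0) (hδ : δ < q ^ m) : 2 * δ ≤
      minDist (matrixProductCode ![bchCode K n β δ, hermitianDual q (bchCode K n β δ)] A) :=
  le_minDist_matrixProductCode_bchCode hq (by omega) hK hL hn hβ hA hA0 le_rfl
    fun _ hv hv0 => le_hammingNorm_hermitianDual_of_odd hq hm hmo hK hL hn hβ hδ hv hv0

end Main

end BCHMatrixProduct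

theorem mainTheorem6 (q m : ℕ) (hq : IsPrimePow q) (hm : 3 ≤ m)
    (K L : Type*) [Field K] [DecidableEq K] [Field L] [Algebra K L]
    (hK : Nat.card K = q ^ 2) (hL : Module.finrank K L = m)
    (n : ℕ) (hn : n = (q ^ 2) ^ m - 1)
    (β : L) (hβ : IsPrimitiveRoot β n)
    (A : Matrix (Fin 2) (Fin 2) K) (hA : A.det ≠ 0)
    (δ : ℕ) (C' : Submodule K (Fin (2 * n) → K))
    (hC' : C' = BCHMatrixProduct.matrixProductCode
      ![BCHMatrixProduct.bchCode K n β δ,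
        BCHMatrixProduct.hermitianDual q (BCHMatrixProduct.bchCode K n β δ)] A) :
    Module.finrank K C' = n ∧
    ((∀ j, A 0 j ≠ 0) →
      -- the first bound
      (∀ a s : ℕ, Even m → (q : ℝ) ≤ √(2 * s + (a : ℝ) ^ 2) + a →
        1 ≤ a → (a : ℝ) ≤ q - 2 → (s : ℝ) ≤ q - 1 →
        ((a : ℝ) * q + s) * (q : ℝ) ^ (m - 1) ≤ δ →
        (δ : ℝ) ≤ ((a : ℝ) * q + s + 1) * (q : ℝ) ^ (m - 1) - 1 →
        √(2 * n) < (q : ℝ) ^ (m + 1) - a * q - s + 1 ∧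
        (q : ℝ) ^ (m + 1) - a * q - s + 1 ≤ BCHMatrixProduct.minDist C') ∧
      -- the second bound
      (∀ s : ℕ, Even m → (s : ℝ) ≤ q - 2 →
        ((q : ℝ) ^ 2 - q + s) * (q : ℝ) ^ (m - 1) ≤ δ →
        (δ : ℝ) ≤ ((q : ℝ) ^ 2 - q + s + 1) * (q : ℝ) ^ (m - 1) - 1 →
        √(2 * n) < (q : ℝ) ^ (m + 1) - (q : ℝ) ^ 2 + q - s + 1 ∧
        (q : ℝ) ^ (m + 1) - (q : ℝ) ^ 2 + q - s + 1 ≤ BCHMatrixProduct.minDist C') ∧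
      -- the third bound
      (Even m →
        ((q : ℝ) ^ 2 - 1) * (q : ℝ) ^ (m - 1) ≤ δ →
        (δ : ℝ) ≤ (q : ℝ) ^ (m + 1) - (q : ℝ) ^ 2 + 1 →
        √(2 * n) < (q : ℝ) ^ (m + 1) - (q : ℝ) ^ 2 + 2 ∧
        (q : ℝ) ^ (m + 1) - (q : ℝ) ^ 2 + 2 ≤ BCHMatrixProduct.minDist C') ∧
      -- the bound `2 * δ`, case (1)
      (∀ b : ℕ, Odd m → 1 ≤ b → (b : ℝ) ≤ (q : ℝ) ^ 2 - 2 → (δ : ℝ) = (q : ℝ) ^ m - b →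
        √(2 * n) < (2 * δ : ℝ) ∧ 2 * δ ≤ BCHMatrixProduct.minDist C') ∧
      -- case (2)
      (∀ a s : ℕ, Even m → √(2 * s + (a : ℝ) ^ 2) + a < (q : ℝ) →
        1 ≤ a → (a : ℝ) ≤ q - 2 → (s : ℝ) ≤ q - 1 →
        ((a : ℝ) * q + s) * (q : ℝ) ^ (m - 1) ≤ δ →
        (δ : ℝ) ≤ ((a : ℝ) * q + s + 1) * (q : ℝ) ^ (m - 1) - 1 →
        √(2 * n) < (2 * δ : ℝ) ∧ 2 * δ ≤ BCHMatrixProduct.minDist C') ∧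
      -- case (3)
      (∀ s : ℕ, Even m → (s : ℝ) * (q : ℝ) ^ (m - 1) ≤ δ →
        (δ : ℝ) ≤ ((s : ℝ) + 1) * (q : ℝ) ^ (m - 1) - 1 →
        √2 / 2 * q < (s : ℝ) → (s : ℝ) ≤ q - 1 →
        √(2 * n) < (2 * δ : ℝ) ∧ 2 * δ ≤ BCHMatrixProduct.minDist C') ∧
      -- case (4)
      (∀ a s : ℕ, Odd m → (√2 * (q : ℝ) ^ 2 - 2 * s) / (2 * q) ≤ (a : ℝ) → (a : ℝ) ≤ q - 2 →
        (s : ℝ) ≤ q - 1 →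
        ((a : ℝ) * q + s) * (q : ℝ) ^ (m - 2) ≤ δ →
        (δ : ℝ) ≤ ((a : ℝ) * q + s + 1) * (q : ℝ) ^ (m - 2) - 1 →
        √(2 * n) < (2 * δ : ℝ) ∧ 2 * δ ≤ BCHMatrixProduct.minDist C') ∧
      -- case (5)
      (∀ s : ℕ, Odd m → (s : ℝ) ≤ q - 2 → 4 ≤ q →
        ((q : ℝ) ^ 2 - q + s) * (q : ℝ) ^ (m - 2) ≤ δ →
        (δ : ℝ) ≤ ((q : ℝ) ^ 2 - q + s + 1) * (q : ℝ) ^ (m - 2) - 1 →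
        √(2 * n) < (2 * δ : ℝ) ∧ 2 * δ ≤ BCHMatrixProduct.minDist C') ∧
      -- case (6)
      (Odd m →
        ((q : ℝ) ^ 2 - 1) * (q : ℝ) ^ (m - 2) ≤ δ →
        (δ : ℝ) ≤ (q : ℝ) ^ m - (q : ℝ) ^ 2 + 1 →
        √(2 * n) < (2 * δ : ℝ) ∧ 2 * δ ≤ BCHMatrixProduct.minDist C')) := by
  subst hC'
  refine ⟨BCHMatrixProduct.finrank_matrixProductCode_bchCode hq hK β hA, fun hA0 => ?_⟩
  have hq0 : 0 < q := hq.pos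
  have hq2 : 2 ≤ q := hq.two_le
  have hqR : (2 : ℝ) ≤ q := by exact_mod_cast hq2
  have hn1 := BCHMatrixProduct.add_one_eq_pow hq0 hn
  have hsqrt : √2 * (q : ℝ) ^ m ≤ 17 / 12 * (q : ℝ) ^ m :=
    mul_le_mul_of_nonneg_right BCHMatrixProduct.sqrt_two_le (by positivity)
  have hP0 : (0 : ℝ) < (q : ℝ) ^ (m - 1) := by positivity
  have hW0 : (0 : ℝ) < (q : ℝ) ^ (m - 2) := by positivity
  have hmP : (q : ℝ) ^ m = q * (q : ℝ) ^ (m - 1) := by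
    rw [← pow_succ']; congr 1; omega
  have hmW : (q : ℝ) ^ m = (q : ℝ) ^ 2 * (q : ℝ) ^ (m - 2) := by
    rw [← pow_add]; congr 1; omega
  have hMP : q ^ (m + 1) = q ^ 2 * q ^ (m - 1) := BCHMatrixProduct.pow_succ_eq (by omega)
  have heven : Even m → 4 ≤ m := by
    rintro ⟨r, hr⟩
    omega
  have hodd : ∀ b : ℝ, 1 ≤ b → (δ : ℝ) ≤ (q : ℝ) ^ m - b → δ < q ^ m := by
    intro b hb h
    have : (δ : ℝ) < (q : ℝ) ^ m := by linarith
    exact_mod_cast this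
  have hodd' : ∀ c : ℝ, c ≤ (q : ℝ) ^ 2 → (δ : ℝ) ≤ c * (q : ℝ) ^ (m - 2) - 1 → δ < q ^ m := by
    intro c hc h
    refine hodd 1 le_rfl (h.trans ?_)
    rw [hmW]
    linarith [mul_le_mul_of_nonneg_right hc hW0.le]
  refine ⟨?_, ?_, ?_, ?_, ?_, ?_, ?_, ?_, ?_⟩
  · intro a s hme h1 ha1 ha2 hs h2 h3
    have hm4 := heven hme
    have ha2' : a + 2 ≤ q := by
      have : (a : ℝ) + 2 ≤ q := by linarith
      exact_mod_cast this
    have hs' : s + 1 ≤ q := by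
      have : (s : ℝ) + 1 ≤ q := by linarith
      exact_mod_cast this
    -- Squaring q - a ≤ √(2s + a²) cancels a²; the square-root hypothesis is exactly q² ≤ 2c for c =
    -- aq + s.
    have hc : q ^ 2 ≤ 2 * (a * q + s) := by
      have e1 : (q : ℝ) - a ≤ √(2 * s + (a : ℝ) ^ 2) := by linarith
      rw [Real.le_sqrt' (by linarith)] at e1
      have : (q : ℝ) ^ 2 ≤ 2 * (a * q + s) := by linarith
      exact_mod_cast this
    have hc' : a * q + s + 1 + q ≤ q ^ 2 := by
      have : (a + 2) * q ≤ q * q := Nat.mul_le_mul_right q ha2'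
      rw [sq]
      linarith
    have h2' : (a * q + s) * q ^ (m - 1) ≤ δ := by exact_mod_cast h2
    have h3' : δ + 1 ≤ (a * q + s + 1) * q ^ (m - 1) := by
      have : (δ : ℝ) + 1 ≤ (a * q + s + 1) * (q : ℝ) ^ (m - 1) := by linarith
      exact_mod_cast this
    have hδ' : δ + q ^ 2 ≤ q ^ (m + 1) + 1 := by
      have e1 : (a * q + s + 2) * q ^ (m - 1) ≤ q ^ 2 * q ^ (m - 1) :=
        Nat.mul_le_mul_right _ (by omega)
      have e2 : (a * q + s + 2) * q ^ (m - 1) =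
        (a * q + s + 1) * q ^ (m - 1) + q ^ (m - 1) := by ring
      have e3 := BCHMatrixProduct.sq_le_pow_sub hq0 hm4
      omega
    have := BCHMatrixProduct.le_minDist_of_even hq hm4 hme hK hL hn hβ hA hA0 hc (by omega) h2' h3'
      hδ'
    push_cast at this
    rwa [← sub_sub] at this
  · intro s hme hs h2 h3
    have hm4 := heven hme
    have hs' : s + 2 ≤ q := by
      have : (s : ℝ) + 2 ≤ q := by linarith
      exact_mod_cast this
    have hqq : 2 * q ≤ q ^ 2 := by rw [sq]; exact Nat.mul_le_mul_right q hq2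
    obtain ⟨c, hc⟩ : ∃ c, c = q ^ 2 - q + s := ⟨_, rfl⟩
    have hcR : (c : ℝ) = (q : ℝ) ^ 2 - q + s := by
      rw [hc, Nat.cast_add, Nat.cast_sub (by omega), Nat.cast_pow]
    rw [← hcR] at h2 h3
    have h2' : c * q ^ (m - 1) ≤ δ := by exact_mod_cast h2
    have h3' : δ + 1 ≤ (c + 1) * q ^ (m - 1) := by
      have : (δ : ℝ) + 1 ≤ (c + 1) * (q : ℝ) ^ (m - 1) := by linarith
      exact_mod_cast this
    have hδ' : δ + q ^ 2 ≤ q ^ (m + 1) + 1 := by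
      have e1 : (c + 2) * q ^ (m - 1) ≤ q ^ 2 * q ^ (m - 1) := Nat.mul_le_mul_right _ (by omega)
      have e2 : (c + 2) * q ^ (m - 1) = (c + 1) * q ^ (m - 1) + q ^ (m - 1) := by ring
      have e3 := BCHMatrixProduct.sq_le_pow_sub hq0 hm4
      omega
    have := BCHMatrixProduct.le_minDist_of_even hq hm4 hme hK hL hn hβ hA hA0 (by omega) (by omega)
      h2' h3' hδ'
    rw [hcR] at this
    convert this using 2 <;> ring
  · intro hme h2 h3
    have hm4 := heven hme
    have hqq : 2 * q ≤ q ^ 2 := by rw [sq]; exact Nat.mul_le_mul_right q hq2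
    obtain ⟨c, hc⟩ : ∃ c, c + 1 = q ^ 2 := ⟨q ^ 2 - 1, Nat.sub_add_cancel (by omega)⟩
    have hcR : (c : ℝ) = (q : ℝ) ^ 2 - 1 := by
      rw [eq_sub_iff_add_eq]
      exact_mod_cast hc
    rw [← hcR] at h2
    have h2' : c * q ^ (m - 1) ≤ δ := by exact_mod_cast h2
    have hδ' : δ + q ^ 2 ≤ q ^ (m + 1) + 1 := by
      have : (δ : ℝ) + (q : ℝ) ^ 2 ≤ (q : ℝ) ^ (m + 1) + 1 := by linarith
      exact_mod_cast this
    have := BCHMatrixProduct.le_minDist_of_even hq hm4 hme hK hL hn hβ hA hA0 (by omega) (by omega)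
      h2' (by rw [hc]; omega) hδ'
    rw [hcR] at this
    convert this using 2 <;> ring
  · intro b hmo hb1 hb2 h
    have hb1' : (1 : ℝ) ≤ b := by exact_mod_cast hb1
    refine ⟨BCHMatrixProduct.sqrt_two_mul_lt hq0 hn1 (hsqrt.trans ?_),
      BCHMatrixProduct.two_mul_le_minDist_of_odd hq hm hmo hK hL hn hβ hA hA0 (hodd b hb1' h.le)⟩
    have e1 : (q : ℝ) ^ 3 ≤ (q : ℝ) ^ m := pow_le_pow_right₀ (by linarith) hm
    have e2 : 24 * (q : ℝ) ^ 2 - 48 ≤ 7 * (q : ℝ) ^ 3 := by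
      rcases (by omega : q = 2 ∨ q = 3 ∨ 4 ≤ q) with rfl | rfl | hq4
      · norm_num
      · norm_num
      · have hq4' : (4 : ℝ) ≤ q := by exact_mod_cast hq4
        nlinarith [mul_le_mul_of_nonneg_right hq4' (sq_nonneg (q : ℝ))]
    linarith
  · intro a s hme h1 ha1 ha2 hs h2 h3
    have hm4 := heven hme
    have ha1' : (1 : ℝ) ≤ a := by exact_mod_cast ha1
    have ha2' : a + 2 ≤ q := by
      have : (a : ℝ) + 2 ≤ q := by linarith
      exact_mod_cast this
    have hc : 2 * (a * q + s) < q ^ 2 := by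
      have e1 : √(2 * s + (a : ℝ) ^ 2) < (q : ℝ) - a := by linarith
      rw [Real.sqrt_lt' (by linarith)] at e1
      have : 2 * (a * q + s) < (q : ℝ) ^ 2 := by linarith
      exact_mod_cast this
    have h3' : δ + 1 ≤ (a * q + s + 1) * q ^ (m - 1) := by
      have : (δ : ℝ) + 1 ≤ (a * q + s + 1) * (q : ℝ) ^ (m - 1) := by linarith
      exact_mod_cast this
    refine ⟨BCHMatrixProduct.sqrt_two_mul_lt hq0 hn1 (hsqrt.trans ?_),
      BCHMatrixProduct.two_mul_le_minDist_of_even hq (by omega) hm4 hme hK hL hn hβ hA hA0 hc h3'⟩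
    have e1 : (q : ℝ) ≤ a * q + s := by
      have : 1 * (q : ℝ) ≤ a * q := mul_le_mul_of_nonneg_right ha1' (by linarith)
      have : (0 : ℝ) ≤ s := s.cast_nonneg
      linarith
    have e2 := mul_le_mul_of_nonneg_right e1 hP0.le
    have e3 : (0 : ℝ) ≤ (q : ℝ) ^ m := by positivity
    linarith
  · intro s hme h2 h3 h4 hs
    have hm4 := heven hme
    have hs' : s + 1 ≤ q := by
      have : (s : ℝ) + 1 ≤ q := by linarith
      exact_mod_cast this
    have h3' : δ + 1 ≤ (s + 1) * q ^ (m - 1) := by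
      have : (δ : ℝ) + 1 ≤ (s + 1) * (q : ℝ) ^ (m - 1) := by linarith
      exact_mod_cast this
    -- For q = 2 the range √2 < s ≤ 1 is empty.
    have hq3 : 3 ≤ q := by
      by_contra! hlt
      obtain rfl : q = 2 := by omega
      have : (1 : ℝ) ≤ √2 := Real.one_le_sqrt.2 (by norm_num)
      push_cast at h4 hs
      linarith
    refine ⟨BCHMatrixProduct.sqrt_two_mul_lt hq0 hn1 ?_,
      BCHMatrixProduct.two_mul_le_minDist_of_even hq hq3 hm4 hme hK hL hn hβ hA hA0 ?_ h3'⟩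
    · have e1 := mul_le_mul_of_nonneg_right h4.le hP0.le
      rw [hmP]
      linarith
    · have : 3 * q ≤ q ^ 2 := by rw [sq]; exact Nat.mul_le_mul_right q hq3
      omega
  · intro a s hmo h1 ha2 hs h2 h3
    have hq0R : (0 : ℝ) < 2 * q := by linarith
    rw [div_le_iff₀ hq0R] at h1
    refine ⟨BCHMatrixProduct.sqrt_two_mul_lt hq0 hn1 ?_,
      BCHMatrixProduct.two_mul_le_minDist_of_odd hq hm hmo hK hL hn hβ hA hA0
        (hodd' _ ?_ h3)⟩
    · have e1 : √2 * (q : ℝ) ^ 2 ≤ 2 * (a * q + s) := by linarith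
      have e2 := mul_le_mul_of_nonneg_right e1 hW0.le
      rw [hmW]
      linarith
    · have := mul_le_mul_of_nonneg_right ha2 (by linarith : (0 : ℝ) ≤ q)
      linarith
  · intro s hmo hs hq4 h2 h3
    have hq4' : (4 : ℝ) ≤ q := by exact_mod_cast hq4
    refine ⟨BCHMatrixProduct.sqrt_two_mul_lt hq0 hn1 (hsqrt.trans ?_),
      BCHMatrixProduct.two_mul_le_minDist_of_odd hq hm hmo hK hL hn hβ hA hA0
        (hodd' _ (by linarith) h3)⟩
    -- With s = 0 this requires q ≥ 24/7, whence q ≥ 4.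
    have e1 : 17 / 12 * (q : ℝ) ^ 2 ≤ 2 * ((q : ℝ) ^ 2 - q + s) := by
      have : (0 : ℝ) ≤ s := s.cast_nonneg
      nlinarith
    have e2 := mul_le_mul_of_nonneg_right e1 hW0.le
    rw [hmW]
    linarith
  · intro hmo h2 h3
    refine ⟨BCHMatrixProduct.sqrt_two_mul_lt hq0 hn1 (hsqrt.trans ?_),
      BCHMatrixProduct.two_mul_le_minDist_of_odd hq hm hmo hK hL hn hβ hA hA0
        (hodd ((q : ℝ) ^ 2 - 1) (by nlinarith) (by linarith))⟩
    have e1 : 17 / 12 * (q : ℝ) ^ 2 ≤ 2 * ((q : ℝ) ^ 2 - 1) := by nlinarith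
    have e2 := mul_le_mul_of_nonneg_right e1 hW0.le
    rw [hmW]
    linarith
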